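/- Consider finitely many cellular operators in the plane. The base stations (BSs) of operator $m$ form a homogeneous Poisson point process of density $\lambda_m>0$, independently over $m$, and transmit with power $P_m>0$. A typical user of operator $n$ is at the origin. Given all BS positions, the following are independent over all BSs and of each other: the link of a BS at distance $r$ is line-of-sight (type $\mathrm L$) with probability $e^{-\beta r}$ and otherwise non-line-of-sight (type $\mathrm N$), where $\beta\ge 0$; its fading coefficient $h$ is exponential with mean $1$; and its antenna angle $\theta$ is uniform on $(-\pi,\pi)$. The path loss of a type-$p$ link of length $r$ is $C_p r^{-\alpha_p}$ with $C_p,\alpha_p>0$, and the antenna pattern is $G(\theta)=G_1$ if $|\theta|<\theta_{\mathrm b}$ and $G(\theta)=G_2$ otherwise, where $G_1,G_2\ge 0$ and $0\le\theta_{\mathrm b}\le\pi$. The user is associated with the BS that has the strictly largest average received power $P_m C_p r^{-\alpha_p}$ among all BSs of the operators in its access set $S_n$. For a network $m$ and $p\in\{\mathrm L,\mathrm N\}$ let $$I_{mp}=\sum_j P_m\,h_{mj}\,C_p\,\|\mathbf x_{mj}\|^{-\alpha_p}\,G(\theta_{mj})\in[0,\infty],$$ the sum being over all type-$p$ BSs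 of network $m$ other than the serving BS. For $s\in\{\mathrm L,\mathrm N\}$ put $$D^{ks}_{mp}(x)=\Big(\frac{P_mC_p}{P_kC_s}\Big)^{1/\alpha_p}x^{\alpha_s/\alpha_p}\ \text{ if } m\in S_n,\qquad D^{ks}_{mp}(x)=0\ \text{ if } m\notin S_n .$$ Let $k\in S_n$, $s\in\{\mathrm L,\mathrm N\}$ and $t\ge 0$. Conditionally on the user being associated with a type-$s$ BS of operator $k$ at distance $x$ (that is, for almost every $x$ with respect to the conditional law of the serving distance), the Laplace transforms $\mathcal L_{I_{mp}}(t)=\mathbb E[e^{-tI_{mp}}]$ of the LOS and NLOS interference from any network $m$ are $$\mathcal L_{I_{m\mathrm L}}(t)=\exp\!\Big(-2\lambda_m\big[\theta_{\mathrm b}F_{\mathrm L}(\beta,\alpha_{\mathrm L},tG_1P_mC_{\mathrm L},D^{ks}_{m\mathrm L}(x))+(\pi-\theta_{\mathrm b})F_{\mathrm L}(\beta,\alpha_{\mathrm L},tG_2P_mC_{\mathrm L},D^{ks}_{m\mathrm L}(x))\big]\Big),$$ $$\mathcal L_{I_{m\mathrm N}}(t)=\exp\!\Big(-2\lambda_m\big[\theta_{\mathrm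 b}F_{\mathrm N}(\beta,\alpha_{\mathrm N},tG_1P_mC_{\mathrm N},D^{ks}_{m\mathrm N}(x))+(\pi-\theta_{\mathrm b})F_{\mathrm N}(\beta,\alpha_{\mathrm N},tG_2P_mC_{\mathrm N},D^{ks}_{m\mathrm N}(x))\big]\Big),$$ where $$F_{\mathrm L}(b,a,A,x)=\int_x^\infty \frac{e^{-by}Ay^{-a}}{1+Ay^{-a}}\,y\,\mathrm dy,\qquad F_{\mathrm N}(b,a,A,x)=\int_x^\infty (1-e^{-by})\frac{Ay^{-a}}{1+Ay^{-a}}\,y\,\mathrm dy,$$ the integrals take values in $[0,\infty]$, and the conventions $e^{-\infty}=0$ and $0\cdot\infty=0$ are used. -/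

import Mathlib

open MeasureTheory ProbabilityTheory
open scoped ENNReal

namespace MmWave

/-- The plane in which base stations live; the typical user sits at the origin. -/
abbrev Plane : Type := EuclideanSpace ℝ (Fin 2)

/-- Type of the link between a base station and the typical user:
line-of-sight or non-line-of-sight. -/
inductive LinkType : Type
  | los
  | nlos

instance : MeasurableSpace LinkType := ⊤

/-- Parameters of a system of operators indexed by `ι`. -/
structure Params (ι : Type*) where
  /-- Base-station densities `λ_m`. -/
  density : ι → ℝ
  density_pos : ∀ m, 0 < density m
  /-- Transmit powers `P_m`. -/
  power : ι → ℝ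
  power_pos : ∀ m, 0 < power m
  /-- Path-loss gains `C_L`, `C_N`. -/
  gain : LinkType → ℝ
  gain_pos : ∀ p, 0 < gain p
  /-- Path-loss exponents `α_L`, `α_N`. -/
  expo : LinkType → ℝ
  expo_pos : ∀ p, 0 < expo p
  /-- Blocking parameter: a link of length `r` is LOS with probability `exp (-β r)`. -/
  β : ℝ
  β_nonneg : 0 ≤ β
  /-- Antenna gain inside the main lobe. -/
  G₁ : ℝ
  G₁_nonneg : 0 ≤ G₁
  /-- Antenna gain outside the main lobe. -/
  G₂ : ℝ
  G₂_nonneg : 0 ≤ G₂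
  /-- Half beamwidth. -/
  θb : ℝ
  θb_nonneg : 0 ≤ θb
  θb_le_pi : θb ≤ Real.pi
  /-- `access n` is the set of operators whose base stations may serve a user of operator `n`. -/
  access : ι → Set ι

/-! ### Probability laws -/

/-- Number (with multiplicity) of points of the enumerated configuration `X` lying in `A`. -/
noncomputable def count {Ω : Type*} (X : ℕ → Ω → Plane) (A : Set Plane) (ω : Ω) : ℕ∞ :=
  {j : ℕ | X j ω ∈ A}.encard

/-- The random points `X 0, X 1, …` form a Poisson point process with intensity measure `Λ`. -/
structure IsPoissonProcess {Ω : Type*} [MeasurableSpace Ω] (P : Measure Ω)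
    (Λ : Measure Plane) (X : ℕ → Ω → Plane) : Prop where
  /-- The number of points in a set of finite intensity is Poisson distributed. -/
  law : ∀ A : Set Plane, MeasurableSet A → Λ A ≠ ∞ → ∀ c : ℕ,
    P {ω | count X A ω = (c : ℕ∞)} = poissonMeasure (Λ A).toNNReal {c}
  /-- The numbers of points in finitely many disjoint sets are independent. -/
  indep : ∀ (r : ℕ) (A : Fin r → Set Plane), (∀ i, MeasurableSet (A i)) →
    Pairwise (fun i j => Disjoint (A i) (A j)) → iIndepFun (fun i => count X (A i)) P

/-- Law of the type of a link of length `r`: LOS with probability `exp (-β r)`, else NLOS. -/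
noncomputable def typeLaw (β r : ℝ) : Measure LinkType :=
  ENNReal.ofReal (Real.exp (-(β * r))) • Measure.dirac LinkType.los +
    ENNReal.ofReal (1 - Real.exp (-(β * r))) • Measure.dirac LinkType.nlos

/-- Uniform distribution on `(-π, π)`. -/
noncomputable def angleLaw : Measure ℝ :=
  ProbabilityTheory.cond volume (Set.Ioo (-Real.pi) Real.pi)

/-- A random deployment. The `j`-th base station of operator `m` has position `X m j`, link type
`s m j` to the user, fading coefficient `h m j`, and its antenna makes the angle `θ m j` with the
direction of the user when the station is interfering (i.e. not serving the user). -/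
structure IsDeployment {ι : Type*} {Ω : Type*} [MeasurableSpace Ω] (N : Params ι) (P : Measure Ω)
    (X : ι → ℕ → Ω → Plane) (s : ι → ℕ → Ω → LinkType) (h θ : ι → ℕ → Ω → ℝ) : Prop where
  meas_pos : ∀ m j, Measurable (X m j)
  meas_type : ∀ m j, Measurable (s m j)
  meas_fading : ∀ m j, Measurable (h m j)
  meas_angle : ∀ m j, Measurable (θ m j)
  /-- The stations of operator `m` form a homogeneous Poisson process of density `λ_m`. -/
  poisson : ∀ m, IsPoissonProcess P (ENNReal.ofReal (N.density m) • volume) (X m)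
  /-- The deployments of different operators are independent. -/
  indep : iIndepFun (fun (m : ι) (ω : Ω) (j : ℕ) => X m j ω) P
  /-- Given all positions, the types, fading coefficients and angles of all stations are
  independent; the type follows the blocking law at the distance of the station, the fading is
  exponential with mean one (Rayleigh fading) and the angle is uniform. -/
  marks : ∀ (F : Finset (ι × ℕ)) (A : Set (ι → ℕ → Plane)) (T : ι × ℕ → Set LinkType)
    (H Θ : ι × ℕ → Set ℝ), MeasurableSet A → (∀ b, MeasurableSet (T b)) →
    (∀ b, MeasurableSet (H b)) → (∀ b, MeasurableSet (Θ b)) →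
    P {ω | (fun m j => X m j ω) ∈ A ∧
        ∀ b ∈ F, s b.1 b.2 ω ∈ T b ∧ h b.1 b.2 ω ∈ H b ∧ θ b.1 b.2 ω ∈ Θ b} =
      ∫⁻ ω in {ω | (fun m j => X m j ω) ∈ A},
        ∏ b ∈ F, (typeLaw N.β ‖X b.1 b.2 ω‖ (T b) * expMeasure 1 (H b) * angleLaw (Θ b)) ∂P

/-! ### Association -/

/-- Average received power (without antenna gain) of the `j`-th station of operator `m`. -/
noncomputable def avgPower {ι Ω : Type*} (N : Params ι) (X : ι → ℕ → Ω → Plane)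
    (s : ι → ℕ → Ω → LinkType) (m : ι) (j : ℕ) (ω : Ω) : ℝ :=
  N.power m * (N.gain (s m j ω) * ‖X m j ω‖ ^ (-(N.expo (s m j ω))))

/-- A user of operator `n` is associated with the `i`-th station of operator `k`: that station is
accessible, and every other accessible station has smaller average received power. -/
def IsServing {ι Ω : Type*} (N : Params ι) (X : ι → ℕ → Ω → Plane) (s : ι → ℕ → Ω → LinkType)
    (n k : ι) (i : ℕ) (ω : Ω) : Prop :=
  k ∈ N.access n ∧ ∀ m ∈ N.access n, ∀ j : ℕ, (m, j) ≠ (k, i) →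
    avgPower N X s m j ω < avgPower N X s k i ω

/-- The event that a user of operator `n` is associated with a station of operator `k` whose link
is of type `q`. -/
def assocEvent {ι Ω : Type*} (N : Params ι) (X : ι → ℕ → Ω → Plane) (s : ι → ℕ → Ω → LinkType)
    (n k : ι) (q : LinkType) : Set Ω :=
  {ω | ∃ i : ℕ, IsServing N X s n k i ω ∧ s k i ω = q}

open Classical in
/-- Distance from the user (of operator `n`) to its serving station (`0` if there is none). -/
noncomputable def servingDist {ι Ω : Type*} (N : Params ι) (X : ι → ℕ → Ω → Plane)
    (s : ι → ℕ → Ω → LinkType) (n : ι) (ω : Ω) : ℝ :=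
  if hb : ∃ b : ι × ℕ, IsServing N X s n b.1 b.2 ω then
    ‖X hb.choose.1 hb.choose.2 ω‖ else 0

open Classical in
/-- Exclusion radius `D^{kq}_{mp}(x)` of the stations of operator `m` with link type `p`, when a
user of operator `n` is associated with a type `q` station of operator `k` at distance `x`. -/
noncomputable def exclusionRadius {ι : Type*} (N : Params ι) (n k : ι) (q : LinkType) (m : ι)
    (p : LinkType) (x : ℝ) : ℝ :=
  if m ∈ N.access n then
    (N.power m / N.power k * (N.gain p / N.gain q)) ^ (1 / N.expo p) *
      x ^ (N.expo q / N.expo p)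
  else 0

/-! ### Interference -/

open Classical in
/-- Antenna pattern. -/
noncomputable def antenna {ι : Type*} (N : Params ι) (φ : ℝ) : ℝ :=
  if |φ| < N.θb then N.G₁ else N.G₂

open Classical in
/-- Interference at a user of operator `n` from the type `p` stations of operator `m`: total power
received from these stations, the serving station being left out. -/
noncomputable def interference {ι Ω : Type*} (N : Params ι) (X : ι → ℕ → Ω → Plane)
    (s : ι → ℕ → Ω → LinkType) (h θ : ι → ℕ → Ω → ℝ) (n m : ι) (p : LinkType) (ω : Ω) : ℝ≥0∞ :=
  ∑' j : ℕ, if s m j ω = p ∧ ¬ IsServing N X s n m j ω then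
    ENNReal.ofReal (N.power m * h m j ω * (N.gain p * ‖X m j ω‖ ^ (-(N.expo p))) *
      antenna N (θ m j ω)) else 0

open Classical in
/-- `exp (-z)` for `z ∈ [0, ∞]`, with `exp (-∞) = 0`. -/
noncomputable def expNeg (z : ℝ≥0∞) : ℝ :=
  if z = ∞ then 0 else Real.exp (-z.toReal)

/-- `F_L(b, a, A, x)`, with values in `[0, ∞]`. -/
noncomputable def FL (b a A x : ℝ) : ℝ≥0∞ :=
  ∫⁻ y in Set.Ioi x,
    ENNReal.ofReal (Real.exp (-(b * y)) * (A * y ^ (-a) / (1 + A * y ^ (-a))) * y)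

/-- `F_N(b, a, A, x)`, with values in `[0, ∞]`. -/
noncomputable def FN (b a A x : ℝ) : ℝ≥0∞ :=
  ∫⁻ y in Set.Ioi x,
    ENNReal.ofReal ((1 - Real.exp (-(b * y))) * (A * y ^ (-a) / (1 + A * y ^ (-a))) * y)

/-- Conditional Laplace transform at `t` of the `[0, ∞]`-valued variable `I` under `P`, given the
event `E` and the value of the real random variable `D`. -/
noncomputable def condLaplace {Ω : Type*} [MeasurableSpace Ω] (P : Measure Ω) (E : Set Ω)
    (D : Ω → ℝ) (I : Ω → ℝ≥0∞) (t : ℝ) : Ω → ℝ :=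
  condExp (MeasurableSpace.comap D inferInstance) (ProbabilityTheory.cond P E)
    (fun ω => expNeg (ENNReal.ofReal t * I ω))

end MmWave

/-! The association event is decomposed over candidate serving stations. A type `q` station of
operator `k` at distance `r` serves the user exactly when every other station lies beyond its own
exclusion radius at `r`. So the indicator of this event times `exp (-t I)` is a product, over all
other stations, of weights in `[0, 1]` that vanish inside the exclusion region
(`tsum_infProd_stationWeight`).

If the random threshold `r` in these weights is frozen at a constant `v`, the expectation is
computable. The marks integrate out one station at a time (`IsDeployment.lintegral_infProd_marks`).
Then the Mecke formula for products gives `f_t(v) ν(B)` for candidates with distance in `B`, where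
`ν` is `distIntensity` and `f_t(v) = exp (-∑ ∫ (1 - mean weight))` is `weightDensity`. Only this
product form of Mecke's formula is needed. It follows from the generating functional of a Poisson
process by comparing the first order terms in `ε` of `E ∏ (g + ε φ)`.

The frozen threshold is removed by monotonicity. The weights decrease in `v`, so for distances in
`[a, b)` the true expectation lies between `f_t(b) ν[a, b)` and `f_t(a) ν[a, b)`. Since `ν` of a
short interval is at most a constant times its length, locally, the law of the serving distance
weighted with `exp (-t I)` must have density `f_t` with respect to `ν`
(`eq_withDensity_of_sandwich`, `laplaceMeasure_eq`).

Passing from `0` to `t` changes one minus the mean weight only by an added loss term, for the chosen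
operator and link type. Hence `f_t = f_0 * exp (-∫ loss)` (`weightDensity_eq_mul`). The factor `f_0`
encodes the exclusion alone and is the density of the unweighted law, so `exp (-∫ loss)` is the
density of the weighted law relative to the unweighted one. This is the defining property of the
conditional expectation given the serving distance. Averaging over fading and antenna angle gives
the fractions `A y^(-a) / (1 + A y^(-a))`, and polar coordinates turn the loss integral into `FL` or
`FN`.

All quantities are kept in `[0, ∞]` with `exp (-∞) = 0`, so divergent integrals and infinite
interference need no separate treatment. -/

namespace MmWave

open Filter Topology

/-! ### The exponential `exp (-z)` on `[0, ∞]` and infinite products of numbers in `[0, 1]` -/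

/-- `exp (-z)` as a map from `[0, ∞]` to itself. -/
noncomputable def nexp (z : ℝ≥0∞) : ℝ≥0∞ := ENNReal.ofReal (expNeg z)

lemma expNeg_nonneg (z : ℝ≥0∞) : 0 ≤ expNeg z := by
  unfold expNeg; split_ifs <;> positivity

lemma nexp_toReal (z : ℝ≥0∞) : (nexp z).toReal = expNeg z :=
  ENNReal.toReal_ofReal (expNeg_nonneg z)

@[simp] lemma nexp_top : nexp ∞ = 0 := by simp [nexp, expNeg]

lemma nexp_of_ne_top {z : ℝ≥0∞} (hz : z ≠ ∞) : nexp z = ENNReal.ofReal (Real.exp (-z.toReal)) := by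
  simp [nexp, expNeg, hz]

lemma nexp_ofReal {x : ℝ} (hx : 0 ≤ x) : nexp (ENNReal.ofReal x) = ENNReal.ofReal (Real.exp (-x)) := by
  rw [nexp_of_ne_top ENNReal.ofReal_ne_top, ENNReal.toReal_ofReal hx]

@[simp] lemma nexp_zero : nexp 0 = 1 := by simp [nexp, expNeg]

lemma nexp_add (a b : ℝ≥0∞) : nexp (a + b) = nexp a * nexp b := by
  by_cases ha : a = ∞
  · simp [ha]
  by_cases hb : b = ∞
  · simp [hb]
  rw [nexp_of_ne_top ha, nexp_of_ne_top hb, nexp_of_ne_top (ENNReal.add_ne_top.2 ⟨ha, hb⟩),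
    ← ENNReal.ofReal_mul (Real.exp_pos _).le, ← Real.exp_add, ENNReal.toReal_add ha hb, neg_add]

lemma nexp_sum {β : Type*} (F : Finset β) (a : β → ℝ≥0∞) :
    nexp (∑ b ∈ F, a b) = ∏ b ∈ F, nexp (a b) := by
  classical
  induction F using Finset.induction_on with
  | empty => simp
  | insert b F hb ih => rw [Finset.sum_insert hb, Finset.prod_insert hb, nexp_add, ih]

lemma nexp_anti : Antitone nexp := by
  intro a b hab
  by_cases hb : b = ∞
  · simp [hb]
  have ha : a ≠ ∞ := ne_top_of_le_ne_top hb hab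
  rw [nexp_of_ne_top ha, nexp_of_ne_top hb]
  gcongr

lemma nexp_le_one (z : ℝ≥0∞) : nexp z ≤ 1 := nexp_zero ▸ nexp_anti (zero_le)

lemma nexp_ne_top (z : ℝ≥0∞) : nexp z ≠ ∞ := ENNReal.ofReal_ne_top

/-- Continuity of `nexp`, including at `∞`, is inherited from the homeomorphism `EReal.exp`. -/
lemma nexp_eq_exp_neg (z : ℝ≥0∞) : nexp z = EReal.exp (-(z : EReal)) := by
  by_cases hz : z = ∞
  · simp [hz]
  · lift z to NNReal using hz
    rw [nexp_of_ne_top ENNReal.coe_ne_top, ENNReal.coe_toReal, ← EReal.exp_coe]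
    rfl

lemma continuous_nexp : Continuous nexp := by
  rw [funext nexp_eq_exp_neg]
  have h : Continuous fun z : ℝ≥0∞ => -(z : EReal) := continuous_coe_ennreal_ereal.neg
  exact EReal.expHomeomorph.continuous.comp h

lemma measurable_nexp : Measurable nexp := continuous_nexp.measurable

/-- Families in `[0, 1]` can be written as exponentials, a zero factor corresponding to the exponent
`∞`. Identities for infinite products thereby reduce to identities for unconditional sums in `[0,
∞]`. -/
lemma exists_nexp_eq {v : ℝ≥0∞} (hv : v ≤ 1) : ∃ a, nexp a = v := by
  by_cases h0 : v = 0
  · exact ⟨∞, by simp [h0]⟩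
  have ht : v ≠ ∞ := ne_top_of_le_ne_top ENNReal.one_ne_top hv
  have hp : 0 < v.toReal := ENNReal.toReal_pos h0 ht
  refine ⟨ENNReal.ofReal (-Real.log v.toReal), ?_⟩
  rw [nexp_ofReal, neg_neg, Real.exp_log hp, ENNReal.ofReal_toReal ht]
  rw [neg_nonneg]
  refine Real.log_nonpos hp.le ?_
  simpa using ENNReal.toReal_mono ENNReal.one_ne_top hv

/-- Product of a family of numbers in `[0, 1]`. -/
noncomputable def infProd {β : Type*} (v : β → ℝ≥0∞) : ℝ≥0∞ := ⨅ F : Finset β, ∏ b ∈ F, v b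

section infProd

variable {β γ : Type*}

lemma infProd_nexp (a : β → ℝ≥0∞) : infProd (fun b => nexp (a b)) = nexp (∑' b, a b) := by
  rw [ENNReal.tsum_eq_iSup_sum,
    nexp_anti.map_ciSup_of_continuousAt continuous_nexp.continuousAt]
  simp only [infProd, nexp_sum]

lemma infProd_le (v : β → ℝ≥0∞) (F : Finset β) : infProd v ≤ ∏ b ∈ F, v b := iInf_le _ F

lemma infProd_mono {v w : β → ℝ≥0∞} (h : ∀ b, v b ≤ w b) : infProd v ≤ infProd w :=
  iInf_mono fun _ => Finset.prod_le_prod' fun b _ => h b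

lemma infProd_le_one (v : β → ℝ≥0∞) : infProd v ≤ 1 := by
  simpa using infProd_le v ∅

lemma infProd_eq_zero {v : β → ℝ≥0∞} {b : β} (h : v b = 0) : infProd v = 0 := by
  have := infProd_le v {b}
  simpa [h] using this

lemma prod_antitone {v : β → ℝ≥0∞} (hv : ∀ b, v b ≤ 1) :
    Antitone fun F : Finset β => ∏ b ∈ F, v b := fun _ _ h =>
  Finset.prod_le_prod_of_subset_of_le_one' h fun b _ _ => hv b

/-- Factors equal to one outside of a finite set can be dropped. -/
lemma infProd_eq_prod {v : β → ℝ≥0∞} (hv : ∀ b, v b ≤ 1) (F : Finset β)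
    (h : ∀ b ∉ F, v b = 1) : infProd v = ∏ b ∈ F, v b := by
  classical
  refine le_antisymm (infProd_le v F) (le_iInf fun F' => ?_)
  rw [Finset.prod_subset (Finset.subset_union_left : F ⊆ F ∪ F') fun b _ hb => h b hb]
  exact prod_antitone hv Finset.subset_union_right

lemma infProd_prod {v : β × γ → ℝ≥0∞} (hv : ∀ b, v b ≤ 1) [Fintype β] :
    infProd v = ∏ b, infProd fun c => v (b, c) := by
  choose a ha using fun b => exists_nexp_eq (hv b)
  have h1 : infProd v = nexp (∑' b, a b) := by rw [← infProd_nexp]; simp only [ha]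
  have h2 : ∀ b, infProd (fun c => v (b, c)) = nexp (∑' c, a (b, c)) := fun b => by
    rw [← infProd_nexp]; simp only [ha]
  rw [h1, Finset.prod_congr rfl fun b _ => h2 b, ← nexp_sum, ENNReal.tsum_prod', tsum_fintype]

lemma infProd_mul {v w : β → ℝ≥0∞} (hv : ∀ b, v b ≤ 1) (hw : ∀ b, w b ≤ 1) :
    infProd (fun b => v b * w b) = infProd v * infProd w := by
  choose a ha using fun b => exists_nexp_eq (hv b)
  choose c hc using fun b => exists_nexp_eq (hw b)
  obtain rfl : (fun b => nexp (a b)) = v := funext ha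
  obtain rfl : (fun b => nexp (c b)) = w := funext hc
  simp only [← nexp_add, infProd_nexp, ENNReal.tsum_add]

lemma infProd_ite (p : β → Prop) [DecidablePred p] [Decidable (∀ b, p b)] (v : β → ℝ≥0∞) :
    infProd (fun b => if p b then v b else 0) = if ∀ b, p b then infProd v else 0 := by
  split_ifs with h
  · simp [h]
  · push Not at h
    obtain ⟨b, hb⟩ := h
    exact infProd_eq_zero (b := b) (by simp [hb])

lemma measurable_infProd [Countable β] {α : Type*} [MeasurableSpace α] {v : β → α → ℝ≥0∞}
    (hv : ∀ b, Measurable (v b)) : Measurable fun x => infProd fun b => v b x :=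
  Measurable.iInf fun F => Finset.measurable_fun_prod F fun b _ => hv b

/-- Integrals of infinite products are limits of integrals of finite products. -/
lemma lintegral_infProd_eq_iInf [Countable β] {α : Type*} [MeasurableSpace α] {μ : Measure α}
    {v : β → α → ℝ≥0∞} (hv : ∀ b, Measurable (v b)) (hv1 : ∀ b x, v b x ≤ 1)
    [IsFiniteMeasure μ] :
    ∫⁻ x, infProd (fun b => v b x) ∂μ = ⨅ F : Finset β, ∫⁻ x, ∏ b ∈ F, v b x ∂μ := by
  by_cases hμ : μ = 0
  · simp [hμ]
  refine lintegral_iInf_directed_of_measurable hμ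
    (fun F => Finset.measurable_fun_prod F fun b _ => hv b) (fun F => ?_) ?_
  · refine ne_top_of_le_ne_top (measure_ne_top μ Set.univ) ?_
    calc ∫⁻ x, ∏ b ∈ F, v b x ∂μ ≤ ∫⁻ x, 1 ∂μ :=
          lintegral_mono fun x => Finset.prod_le_one' fun b _ => hv1 b x
      _ = μ Set.univ := by simp
  · exact directed_of_isDirected_le fun F G h x => prod_antitone (fun b => hv1 b x) h

end infProd

/-! ### Finite products: expansion to first order -/

section Expansion

variable {β : Type*}

/-- In the expansion over subsets, every nonempty subset carries a factor at most `ε`. This zeroth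
order bound closes the induction in `prod_add_mul_le`. -/
lemma prod_add_mul_le_add_mul (T : Finset β) (g φ : β → ℝ≥0∞) {ε : ℝ≥0∞} (hε : ε ≤ 1) :
    ∏ j ∈ T, (g j + ε * φ j) ≤ ∏ j ∈ T, g j + ε * ∏ j ∈ T, (g j + φ j) := by
  classical
  induction T using Finset.induction_on with
  | empty => simp
  | insert a T ha ih =>
    simp only [Finset.prod_insert ha]
    have h1 : ∏ j ∈ T, (g j + ε * φ j) ≤ ∏ j ∈ T, (g j + φ j) :=
      Finset.prod_le_prod' fun j _ => by
        gcongr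
        exact mul_le_of_le_one_left' hε
    calc (g a + ε * φ a) * ∏ j ∈ T, (g j + ε * φ j)
        = g a * ∏ j ∈ T, (g j + ε * φ j) + ε * φ a * ∏ j ∈ T, (g j + ε * φ j) := by ring
      _ ≤ g a * (∏ j ∈ T, g j + ε * ∏ j ∈ T, (g j + φ j)) +
            ε * φ a * ∏ j ∈ T, (g j + φ j) := by gcongr
      _ = _ := by ring

/-- The terms of order two and higher in `ε` are nonnegative and may be dropped. -/
lemma add_le_prod_add_mul [DecidableEq β] (T : Finset β) (g φ : β → ℝ≥0∞) (ε : ℝ≥0∞) :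
    ∏ j ∈ T, g j + ε * ∑ i ∈ T, φ i * ∏ j ∈ T.erase i, g j ≤ ∏ j ∈ T, (g j + ε * φ j) := by
  induction T using Finset.induction_on with
  | empty => simp
  | insert a T ha ih =>
    have hs : ∑ i ∈ T, φ i * ∏ j ∈ (insert a T).erase i, g j =
        g a * ∑ i ∈ T, φ i * ∏ j ∈ T.erase i, g j := by
      rw [Finset.mul_sum]
      refine Finset.sum_congr rfl fun i hi => ?_
      rw [Finset.erase_insert_of_ne (by rintro rfl; exact ha hi),
        Finset.prod_insert (fun h => ha (Finset.mem_of_mem_erase h))]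
      ring
    rw [Finset.prod_insert ha, Finset.prod_insert ha, Finset.sum_insert ha, hs,
      Finset.erase_insert ha]
    calc _ = g a * (∏ j ∈ T, g j + ε * ∑ i ∈ T, φ i * ∏ j ∈ T.erase i, g j) +
          ε * φ a * ∏ j ∈ T, g j := by ring
      _ ≤ g a * ∏ j ∈ T, (g j + ε * φ j) + ε * φ a * ∏ j ∈ T, (g j + ε * φ j) := by
          gcongr
          exact le_self_add
      _ = _ := by ring

/-- Since `ε ≤ 1`, the terms of order at least two are bounded by `ε ^ 2` times the full expansion
at `ε = 1`. Together with the lower bound this replaces differentiation under the integral. -/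
lemma prod_add_mul_le [DecidableEq β] (T : Finset β) (g φ : β → ℝ≥0∞) {ε : ℝ≥0∞} (hε : ε ≤ 1) :
    ∏ j ∈ T, (g j + ε * φ j) ≤ ∏ j ∈ T, g j + ε * ∑ i ∈ T, φ i * ∏ j ∈ T.erase i, g j +
      ε ^ 2 * ∏ j ∈ T, (g j + φ j) := by
  induction T using Finset.induction_on with
  | empty => simp
  | insert a T ha ih =>
    have hs : ∑ i ∈ T, φ i * ∏ j ∈ (insert a T).erase i, g j =
        g a * ∑ i ∈ T, φ i * ∏ j ∈ T.erase i, g j := by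
      rw [Finset.mul_sum]
      refine Finset.sum_congr rfl fun i hi => ?_
      rw [Finset.erase_insert_of_ne (by rintro rfl; exact ha hi),
        Finset.prod_insert (fun h => ha (Finset.mem_of_mem_erase h))]
      ring
    simp only [Finset.prod_insert ha]
    rw [Finset.sum_insert ha, hs, Finset.erase_insert ha]
    calc _ = g a * ∏ j ∈ T, (g j + ε * φ j) + ε * φ a * ∏ j ∈ T, (g j + ε * φ j) := by ring
      _ ≤ g a * (∏ j ∈ T, g j + ε * ∑ i ∈ T, φ i * ∏ j ∈ T.erase i, g j +
            ε ^ 2 * ∏ j ∈ T, (g j + φ j)) +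
          ε * φ a * (∏ j ∈ T, g j + ε * ∏ j ∈ T, (g j + φ j)) := by
          gcongr
          exact prod_add_mul_le_add_mul T g φ hε
      _ = _ := by ring

end Expansion

/-- A number squeezed between the first order expansions of `ε ↦ K * exp (ε * a)`. -/
lemma eq_mul_of_exp_bounds {K a d M : ℝ}
    (h1 : ∀ ε : ℝ, 0 < ε → ε ≤ 1 → K + ε * d ≤ K * Real.exp (ε * a))
    (h2 : ∀ ε : ℝ, 0 < ε → ε ≤ 1 → K * Real.exp (ε * a) ≤ K + ε * d + ε ^ 2 * M) :
    d = K * a := by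
  have hd : Tendsto (fun ε : ℝ => K * ((Real.exp (ε * a) - 1) / ε)) (𝓝[>] 0) (𝓝 (K * a)) := by
    have : HasDerivAt (fun ε : ℝ => Real.exp (ε * a)) a 0 := by
      simpa using ((hasDerivAt_id (0 : ℝ)).mul_const a).exp
    have h3 := this.tendsto_slope_zero_right
    refine (h3.const_mul K).congr fun ε => ?_
    simp [div_eq_inv_mul]
  have hsmall : ∀ᶠ ε : ℝ in 𝓝[>] 0, 0 < ε ∧ ε ≤ 1 := by
    filter_upwards [Ioc_mem_nhdsGT (zero_lt_one' ℝ)] with ε hε using hε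
  have h4 : Tendsto (fun ε : ℝ => d + ε * M) (𝓝[>] 0) (𝓝 d) := by
    have : Tendsto (fun ε : ℝ => d + ε * M) (𝓝 0) (𝓝 (d + 0 * M)) := by
      exact (continuous_const.add (continuous_id.mul continuous_const)).tendsto 0
    rw [zero_mul, add_zero] at this
    exact this.mono_left nhdsWithin_le_nhds
  refine le_antisymm (ge_of_tendsto hd ?_) (le_of_tendsto_of_tendsto hd h4 ?_)
  · filter_upwards [hsmall] with ε hε
    rw [mul_div_assoc', le_div_iff₀ hε.1]
    linarith [h1 ε hε.1 hε.2]
  · filter_upwards [hsmall] with ε hε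
    rw [mul_div_assoc', div_le_iff₀ hε.1]
    nlinarith [h2 ε hε.1 hε.2]

/-! ### Exponential on `[0, ∞]` -/

/-- `exp z` as a map from `[0, ∞]` to itself. -/
noncomputable def pexp (z : ℝ≥0∞) : ℝ≥0∞ := EReal.exp (z : EReal)

lemma pexp_add (a b : ℝ≥0∞) : pexp (a + b) = pexp a * pexp b := by
  rw [pexp, EReal.coe_ennreal_add, EReal.exp_add]; rfl

@[simp] lemma pexp_zero : pexp 0 = 1 := by simp [pexp]

lemma pexp_sum {β : Type*} (F : Finset β) (a : β → ℝ≥0∞) :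
    pexp (∑ b ∈ F, a b) = ∏ b ∈ F, pexp (a b) := by
  classical
  induction F using Finset.induction_on with
  | empty => simp
  | insert b F hb ih => rw [Finset.sum_insert hb, Finset.prod_insert hb, pexp_add, ih]

lemma continuous_pexp : Continuous pexp :=
  EReal.expHomeomorph.continuous.comp continuous_coe_ennreal_ereal

lemma pexp_ofReal {x : ℝ} (hx : 0 ≤ x) : pexp (ENNReal.ofReal x) = ENNReal.ofReal (Real.exp x) := by
  rw [pexp, ← EReal.exp_coe, EReal.coe_ennreal_ofReal, max_eq_left hx]

lemma pexp_mul_nexp {a : ℝ≥0∞} (ha : a ≠ ∞) : pexp a * nexp a = 1 := by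
  lift a to NNReal using ha
  have h := NNReal.coe_nonneg a
  rw [← ENNReal.ofReal_coe_nnreal, pexp_ofReal h, nexp_ofReal h,
    ← ENNReal.ofReal_mul (Real.exp_pos _).le, ← Real.exp_add]
  simp

lemma pexp_mul_nexp_add (a b : ℝ≥0∞) (ha : a ≠ ∞) : pexp a * nexp (a + b) = nexp b := by
  rw [nexp_add, ← mul_assoc, pexp_mul_nexp ha, one_mul]

/-! ### Point counts of a Poisson process -/

section Count

variable {Ω : Type*} [MeasurableSpace Ω] {P : Measure Ω} {Λ : Measure Plane} {X : ℕ → Ω → Plane}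

omit [MeasurableSpace Ω] in
lemma count_coe_eq_tsum (X : ℕ → Ω → Plane) (A : Set Plane) (ω : Ω) :
    (count X A ω : ℝ≥0∞) = ∑' j, A.indicator (fun _ => 1) (X j ω) := by
  rw [count, ← ENNReal.tsum_set_one, tsum_subtype {j : ℕ | X j ω ∈ A} (fun _ => (1 : ℝ≥0∞))]
  rfl

lemma measurable_count (hX : ∀ j, Measurable (X j)) {A : Set Plane} (hA : MeasurableSet A) :
    Measurable (count X A) := by
  refine measurable_to_countable' fun c => ?_
  have : count X A ⁻¹' {c} = (fun ω => ∑' j, A.indicator (fun _ => (1 : ℝ≥0∞)) (X j ω)) ⁻¹' {(c : ℝ≥0∞)} := by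
    ext ω
    simp [← count_coe_eq_tsum]
  rw [this]
  exact (Measurable.tsum fun j => (measurable_const.indicator hA).comp (hX j))
    (measurableSet_singleton _)

/-- The Poisson probabilities of the finite counts already sum to one. -/
lemma ae_count_ne_top [IsProbabilityMeasure P] (hX : ∀ j, Measurable (X j))
    (h : IsPoissonProcess P Λ X) {A : Set Plane} (hA : MeasurableSet A) (hΛ : Λ A ≠ ∞) :
    ∀ᵐ ω ∂P, count X A ω ≠ ⊤ := by
  have hm := measurable_count hX hA
  have h1 : P (⋃ c : ℕ, {ω | count X A ω = (c : ℕ∞)}) = 1 := by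
    rw [measure_iUnion]
    · simp_rw [h.law A hA hΛ]
      have := (measure_univ (μ := poissonMeasure (Λ A).toNNReal))
      rw [← this, ← Set.iUnion_of_singleton, measure_iUnion _ fun _ => measurableSet_singleton _]
      intro i j hij
      simpa using hij
    · intro i j hij
      refine Set.disjoint_left.2 fun ω hi hj => hij ?_
      simp only [Set.mem_ofPred_eq] at hi hj
      exact_mod_cast hi.symm.trans hj
    · exact fun c => hm (measurableSet_singleton _)
  have h2 : MeasurableSet (⋃ c : ℕ, {ω | count X A ω = (c : ℕ∞)}) :=
    MeasurableSet.iUnion fun c => hm (measurableSet_singleton _)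
  have h3 := (prob_compl_eq_zero_iff h2).2 h1
  refine measure_mono_null (fun ω hω => ?_) h3
  simp only [Set.mem_compl_iff, Set.mem_ofPred_eq, not_not] at hω
  simp [hω]

/-- Number of points in `A`, as a natural number (`0` if there are infinitely many). -/
noncomputable def natCount (X : ℕ → Ω → Plane) (A : Set Plane) (ω : Ω) : ℕ := (count X A ω).toNat

lemma map_natCount [IsProbabilityMeasure P] (hX : ∀ j, Measurable (X j))
    (h : IsPoissonProcess P Λ X) {A : Set Plane} (hA : MeasurableSet A) (hΛ : Λ A ≠ ∞) :
    P.map (natCount X A) = poissonMeasure (Λ A).toNNReal := by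
  have hm : Measurable (natCount X A) := (Measurable.of_discrete (f := ENat.toNat)).comp
    (measurable_count hX hA)
  refine Measure.ext_of_singleton fun c => ?_
  rw [Measure.map_apply hm (measurableSet_singleton c), ← h.law A hA hΛ]
  refine measure_congr ?_
  filter_upwards [ae_count_ne_top hX h hA hΛ] with ω hω
  refine propext ?_
  change natCount X A ω = c ↔ count X A ω = c
  rw [natCount, ← Nat.cast_inj (R := ℕ∞), ENat.natCast_toNat hω]

/-- This is the exponential series. Writing `exp ((c - 1) r)` as a product of two exponentials
allows `c > 1` and avoids subtraction in `[0, ∞]`. -/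
lemma lintegral_pow_poissonMeasure (r : NNReal) {c : ℝ≥0∞} (hc : c ≠ ∞) :
    ∫⁻ n, c ^ n ∂(poissonMeasure r) = pexp (c * r) * nexp r := by
  rw [lintegral_countable']
  lift c to NNReal using hc
  have h1 : ∀ n : ℕ, (c : ℝ≥0∞) ^ n * poissonMeasure r {n} =
      ENNReal.ofReal (((c * r : ℝ)) ^ n / n.factorial) * ENNReal.ofReal (Real.exp (-r)) := by
    intro n
    rw [poissonMeasure_singleton, ← ENNReal.ofReal_coe_nnreal, ← ENNReal.ofReal_pow (by positivity),
      ← ENNReal.ofReal_mul (by positivity), ← ENNReal.ofReal_mul (by positivity)]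
    congr 1
    rw [mul_pow]; ring
  simp_rw [h1]
  rw [ENNReal.tsum_mul_right, ← ENNReal.ofReal_tsum_of_nonneg (fun n => by positivity)
    (Real.summable_pow_div_factorial _), ← ENNReal.ofReal_coe_nnreal, ← ENNReal.ofReal_coe_nnreal,
    ← ENNReal.ofReal_mul (p := (c : ℝ)) (by positivity), pexp_ofReal (by positivity), nexp_ofReal (by positivity),
    Real.exp_eq_exp_ℝ, NormedSpace.exp_eq_tsum_div]

end Count

/-! ### Generating functional on sets of finite intensity -/

section FiniteProduct

variable {Ω : Type*} [MeasurableSpace Ω] {P : Measure Ω} {Λ : Measure Plane} {X : ℕ → Ω → Plane}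

open Classical in
/-- Product of the values of `f` at the points in `A`. -/
noncomputable def prodOn (X : ℕ → Ω → Plane) (A : Set Plane) (f : Plane → ℝ≥0∞) (ω : Ω) : ℝ≥0∞ :=
  liminf (fun J => ∏ j ∈ Finset.range J, A.piecewise f 1 (X j ω)) atTop

-- The lower limit in `prodOn` secures measurability; when `A` contains finitely many points the
-- partial products are eventually constant. Unlike `infProd`, this product is also correct for
-- factors larger than one, which the perturbation `g + ε φ` produces.
omit [MeasurableSpace Ω] in
open Classical in
lemma prodOn_eq {A : Set Plane} {ω : Ω} {T : Finset ℕ} (hT : ∀ j, j ∈ T ↔ X j ω ∈ A)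
    (f : Plane → ℝ≥0∞) : prodOn X A f ω = ∏ j ∈ T, f (X j ω) := by
  refine Tendsto.liminf_eq (tendsto_const_nhds.congr' ?_)
  filter_upwards [eventually_ge_atTop (T.sup id + 1)] with J hJ
  have hsub : T ⊆ Finset.range J := fun j hj => by
    have : j ≤ T.sup id := Finset.le_sup (f := id) hj
    simp; omega
  rw [← Finset.prod_subset hsub]
  · exact Finset.prod_congr rfl fun j hj => by simp [(hT j).1 hj]
  · intro j _ hj
    have : X j ω ∉ A := fun h => hj ((hT j).2 h)
    simp [this]

lemma measurable_prodOn (hX : ∀ j, Measurable (X j)) {A : Set Plane} (hA : MeasurableSet A)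
    {f : Plane → ℝ≥0∞} (hf : Measurable f) : Measurable (prodOn X A f) := by
  classical
  refine Measurable.liminf fun J => Finset.measurable_fun_prod _ fun j _ => ?_
  exact (Measurable.piecewise hA hf measurable_one).comp (hX j)

lemma ae_exists_finset [IsProbabilityMeasure P] (hX : ∀ j, Measurable (X j))
    (h : IsPoissonProcess P Λ X) {A : Set Plane} (hA : MeasurableSet A) (hΛ : Λ A ≠ ∞) :
    ∀ᵐ ω ∂P, ∃ T : Finset ℕ, ∀ j, j ∈ T ↔ X j ω ∈ A := by
  filter_upwards [ae_count_ne_top hX h hA hΛ] with ω hω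
  have : {j : ℕ | X j ω ∈ A}.Finite := Set.encard_ne_top_iff.1 hω
  exact ⟨this.toFinset, fun j => by simp⟩

/-- The level sets of `f` cut `A` into disjoint pieces, and the product becomes a product of powers
`c ^ count`. The counts are independent and Poisson, so the expectation factors and the exponents
add up to the integral of `f` and to `Λ A`. -/
lemma lintegral_prodOn_simpleFunc [IsProbabilityMeasure P] (hX : ∀ j, Measurable (X j))
    (h : IsPoissonProcess P Λ X) {A : Set Plane} (hA : MeasurableSet A) (hΛ : Λ A ≠ ∞)
    (f : SimpleFunc Plane ℝ≥0∞) (hf : ∀ y, f y ≠ ∞) :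
    ∫⁻ ω, prodOn X A f ω ∂P = pexp (∫⁻ y in A, f y ∂Λ) * nexp (Λ A) := by
  classical
  let e := f.range.equivFin
  let B : Fin f.range.card → Set Plane := fun i => A ∩ f ⁻¹' {(e.symm i : ℝ≥0∞)}
  have hB : ∀ i, MeasurableSet (B i) := fun i => hA.inter (f.measurableSet_fiber _)
  have hBΛ : ∀ i, Λ (B i) ≠ ∞ := fun i => measure_ne_top_of_subset Set.inter_subset_left hΛ
  have hdisj : Pairwise fun i j => Disjoint (B i) (B j) := by
    intro i j hij
    refine Set.disjoint_left.2 fun y hi hj => hij ?_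
    have := hi.2.symm.trans hj.2
    exact e.symm.injective (Subtype.ext this)
  have hprod : ∀ᵐ ω ∂P, prodOn X A f ω = ∏ i, (e.symm i : ℝ≥0∞) ^ natCount X (B i) ω := by
    filter_upwards [ae_exists_finset hX h hA hΛ] with ω ⟨T, hT⟩
    rw [prodOn_eq hT, ← Finset.prod_fiberwise_of_maps_to (t := f.range) (g := fun j => f (X j ω))
      (fun j _ => f.mem_range_self _), ← Finset.prod_coe_sort, ← e.symm.prod_comp]
    refine Finset.prod_congr rfl fun i _ => ?_
    rw [Finset.prod_congr rfl (g := fun _ => (e.symm i : ℝ≥0∞))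
      (fun j hj => (Finset.mem_filter.1 hj).2), Finset.prod_const]
    congr 1
    have : {j : ℕ | X j ω ∈ B i} = ↑(T.filter fun j => f (X j ω) = e.symm i) := by
      ext j; simp [B, hT]
    rw [natCount, count, this, Set.encard_coe_eq_coe_finsetCard, ENat.toNat_natCast]
  have hpow : ∀ c : ℝ≥0∞, Measurable fun x : ℕ∞ => c ^ x.toNat := fun c => Measurable.of_discrete
  have hind := (h.indep _ B hB hdisj).comp (fun i x => (e.symm i : ℝ≥0∞) ^ x.toNat)
    fun i => hpow _
  rw [lintegral_congr_ae hprod]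
  have h1 := lintegral_prod_eq_prod_lintegral_of_indepFun Finset.univ _ hind
    (fun i => (hpow _).comp (measurable_count hX (hB i)))
  have h2 : ∀ i, ∫⁻ ω, (e.symm i : ℝ≥0∞) ^ natCount X (B i) ω ∂P =
      pexp ((e.symm i : ℝ≥0∞) * Λ (B i)) * nexp (Λ (B i)) := by
    intro i
    have hc : (e.symm i : ℝ≥0∞) ≠ ∞ := by
      obtain ⟨y, hy⟩ := SimpleFunc.mem_range.1 (e.symm i).2
      rw [← hy]; exact hf y
    have hm : Measurable (natCount X (B i)) := (Measurable.of_discrete (f := ENat.toNat)).comp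
      (measurable_count hX (hB i))
    rw [← lintegral_map (f := fun n : ℕ => (e.symm i : ℝ≥0∞) ^ n) Measurable.of_discrete hm,
      map_natCount hX h (hB i) (hBΛ i), lintegral_pow_poissonMeasure _ hc,
      ENNReal.coe_toNNReal (hBΛ i)]
  refine h1.trans ((Finset.prod_congr rfl fun i _ => h2 i).trans ?_)
  rw [Finset.prod_mul_distrib, ← pexp_sum, ← nexp_sum]
  congr 2
  · refine Eq.trans ?_ (SimpleFunc.lintegral_eq_lintegral f (Λ.restrict A)).symm
    rw [SimpleFunc.lintegral, ← Finset.sum_coe_sort f.range,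
      ← e.symm.sum_comp]
    refine Finset.sum_congr rfl fun i _ => ?_
    rw [Measure.restrict_apply (f.measurableSet_fiber _), Set.inter_comm]
  · rw [← measure_biUnion_finset (fun i _ j _ hij => hdisj hij) fun i _ => hB i]
    congr 1
    ext y
    simp only [B, Finset.mem_univ, Set.iUnion_true, Set.mem_iUnion, Set.mem_inter_iff,
      Set.mem_preimage, Set.mem_singleton_iff, exists_and_left, and_iff_left_iff_imp]
    exact fun _ => ⟨e ⟨f y, f.mem_range_self y⟩, by simp⟩

/-- Generating functional of a Poisson process. -/
lemma lintegral_prodOn [IsProbabilityMeasure P] (hX : ∀ j, Measurable (X j))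
    (h : IsPoissonProcess P Λ X) {A : Set Plane} (hA : MeasurableSet A) (hΛ : Λ A ≠ ∞)
    {f : Plane → ℝ≥0∞} (hf : Measurable f) (hf' : ∀ y, f y ≠ ∞) :
    ∫⁻ ω, prodOn X A f ω ∂P = pexp (∫⁻ y in A, f y ∂Λ) * nexp (Λ A) := by
  have h1 : Tendsto (fun n => ∫⁻ ω, prodOn X A (SimpleFunc.eapprox f n) ω ∂P) atTop
      (𝓝 (∫⁻ ω, prodOn X A f ω ∂P)) := by
    refine lintegral_tendsto_of_tendsto_of_monotone
      (fun n => (measurable_prodOn hX hA (SimpleFunc.measurable _)).aemeasurable) ?_ ?_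
    · filter_upwards [ae_exists_finset hX h hA hΛ] with ω ⟨T, hT⟩ n m hnm
      simp only [prodOn_eq hT]
      exact Finset.prod_le_prod' fun j _ => SimpleFunc.monotone_eapprox f hnm _
    · filter_upwards [ae_exists_finset hX h hA hΛ] with ω ⟨T, hT⟩
      simp only [prodOn_eq hT]
      -- Finiteness of `f` matters here: multiplication is discontinuous at `(0, ∞)`.
      exact ENNReal.tendsto_finsetProd_of_ne_top _
        (fun j _ => SimpleFunc.tendsto_eapprox hf _) (fun j _ => hf' _)
  have h2 : Tendsto (fun n => pexp (∫⁻ y in A, SimpleFunc.eapprox f n y ∂Λ) * nexp (Λ A)) atTop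
      (𝓝 (pexp (∫⁻ y in A, f y ∂Λ) * nexp (Λ A))) := by
    refine ENNReal.Tendsto.mul_const ?_ (Or.inr (nexp_ne_top _))
    refine (continuous_pexp.tendsto _).comp (lintegral_tendsto_of_tendsto_of_monotone
      (fun n => (SimpleFunc.measurable _).aemeasurable) ?_ ?_)
    · exact ae_of_all _ fun y n m hnm => SimpleFunc.monotone_eapprox f hnm _
    · exact ae_of_all _ fun y => SimpleFunc.tendsto_eapprox hf _
  refine tendsto_nhds_unique h1 (h2.congr fun n => ?_)
  exact (lintegral_prodOn_simpleFunc hX h hA hΛ _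
    fun y => (SimpleFunc.eapprox_lt_top f n y).ne).symm

end FiniteProduct

/-! ### Mecke formula for products along one Poisson process -/

section Mecke

variable {Ω : Type*} [MeasurableSpace Ω] {P : Measure Ω} {Λ : Measure Plane} {X : ℕ → Ω → Plane}

omit [MeasurableSpace Ω] in
open Classical in
lemma infProd_piecewise_eq {A : Set Plane} {ω : Ω} {T : Finset ℕ} (hT : ∀ j, j ∈ T ↔ X j ω ∈ A)
    {g : Plane → ℝ≥0∞} (hg : ∀ y, g y ≤ 1) :
    infProd (fun j => A.piecewise g 1 (X j ω)) = ∏ j ∈ T, g (X j ω) := by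
  rw [infProd_eq_prod (F := T)]
  · exact Finset.prod_congr rfl fun j hj => by simp [(hT j).1 hj]
  · intro j
    by_cases h : X j ω ∈ A <;> simp [h, hg]
  · intro j hj
    have : X j ω ∉ A := fun h => hj ((hT j).2 h)
    simp [this]

omit [MeasurableSpace Ω] in
open Classical in
lemma infProd_ite_piecewise_eq {A : Set Plane} {ω : Ω} {T : Finset ℕ}
    (hT : ∀ j, j ∈ T ↔ X j ω ∈ A) {g : Plane → ℝ≥0∞} (hg : ∀ y, g y ≤ 1) (i : ℕ) :
    infProd (fun j => if j = i then 1 else A.piecewise g 1 (X j ω)) =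
      ∏ j ∈ T.erase i, g (X j ω) := by
  rw [infProd_eq_prod (F := T.erase i)]
  · refine Finset.prod_congr rfl fun j hj => ?_
    rw [Finset.mem_erase] at hj
    simp [hj.1, (hT j).1 hj.2]
  · intro j
    by_cases h : X j ω ∈ A <;> by_cases hji : j = i <;> simp [h, hg, hji]
  · intro j hj
    by_cases hji : j = i
    · simp [hji]
    · have : X j ω ∉ A := fun h => hj (by simp [hji, (hT j).2 h])
      simp [this]

lemma lintegral_add_lintegral_one_sub (A : Set Plane) {g : Plane → ℝ≥0∞}
    (hgm : Measurable g) (hg : ∀ y, g y ≤ 1) :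
    ∫⁻ y in A, g y ∂Λ + ∫⁻ y in A, (1 - g y) ∂Λ = Λ A := by
  rw [← lintegral_add_left hgm]
  simp [add_tsub_cancel_of_le (hg _)]

open Classical in
/-- Probability generating functional of a Poisson process, restricted to a set of finite
intensity. -/
lemma lintegral_infProd_piecewise [IsProbabilityMeasure P] (hX : ∀ j, Measurable (X j))
    (h : IsPoissonProcess P Λ X) {A : Set Plane} (hA : MeasurableSet A) (hΛ : Λ A ≠ ∞)
    {g : Plane → ℝ≥0∞} (hgm : Measurable g) (hg : ∀ y, g y ≤ 1) :
    ∫⁻ ω, infProd (fun j => A.piecewise g 1 (X j ω)) ∂P = nexp (∫⁻ y in A, (1 - g y) ∂Λ) := by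
  have h1 : ∫⁻ ω, infProd (fun j => A.piecewise g 1 (X j ω)) ∂P = ∫⁻ ω, prodOn X A g ω ∂P := by
    refine lintegral_congr_ae ?_
    filter_upwards [ae_exists_finset hX h hA hΛ] with ω ⟨T, hT⟩
    rw [infProd_piecewise_eq hT hg, prodOn_eq hT]
  have h2 := lintegral_add_lintegral_one_sub (Λ := Λ) A hgm hg
  rw [h1, lintegral_prodOn hX h hA hΛ hgm fun y => ne_top_of_le_ne_top ENNReal.one_ne_top (hg y),
    ← h2, pexp_mul_nexp_add]
  exact ne_top_of_le_ne_top hΛ (h2 ▸ le_self_add)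

open Classical in
/-- Mecke formula for products, restricted to a set of finite intensity. -/
lemma lintegral_tsum_mul_infProd_piecewise [IsProbabilityMeasure P] (hX : ∀ j, Measurable (X j))
    (h : IsPoissonProcess P Λ X) {A : Set Plane} (hA : MeasurableSet A) (hΛ : Λ A ≠ ∞)
    {g φ : Plane → ℝ≥0∞} (hgm : Measurable g) (hg : ∀ y, g y ≤ 1)
    (hφm : Measurable φ) (hφ : ∀ y, φ y ≤ 1) :
    ∫⁻ ω, ∑' i, A.indicator φ (X i ω) *
        infProd (fun j => if j = i then 1 else A.piecewise g 1 (X j ω)) ∂P =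
      (∫⁻ y in A, φ y ∂Λ) * nexp (∫⁻ y in A, (1 - g y) ∂Λ) := by
  -- `D` is the coefficient of `ε` in the product of `g + ε φ` over the points in `A`; `K * a` is
  -- the coefficient of `ε` in its expectation `K * exp (ε a)`.
  set D : Ω → ℝ≥0∞ := fun ω => ∑' i, A.indicator φ (X i ω) *
        infProd (fun j => if j = i then 1 else A.piecewise g 1 (X j ω)) with hD
  set a := ∫⁻ y in A, φ y ∂Λ with ha
  set K := nexp (∫⁻ y in A, (1 - g y) ∂Λ) with hK
  have hDm : Measurable D := by
    refine Measurable.tsum fun i => ((hφm.indicator hA).comp (hX i)).mul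
      (measurable_infProd fun j => ?_)
    split_ifs
    · exact measurable_const
    · exact (Measurable.piecewise hA hgm measurable_one).comp (hX j)
  have hDeq : ∀ ω (T : Finset ℕ), (∀ j, j ∈ T ↔ X j ω ∈ A) →
      D ω = ∑ i ∈ T, φ (X i ω) * ∏ j ∈ T.erase i, g (X j ω) := by
    intro ω T hT
    rw [hD]
    simp only [infProd_ite_piecewise_eq hT hg]
    rw [tsum_eq_sum (s := T)]
    · exact Finset.sum_congr rfl fun i hi => by simp [(hT i).1 hi]
    · intro i hi
      have : X i ω ∉ A := fun h => hi ((hT i).2 h)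
      simp [this]
  have hle : ∀ {f : Plane → ℝ≥0∞}, (∀ y, f y ≤ 1) → ∫⁻ y in A, f y ∂Λ ≠ ∞ := fun hf =>
    ne_top_of_le_ne_top hΛ ((lintegral_mono hf).trans (by simp))
  have hQ : ∀ ε : ℝ≥0∞, ε ≠ ∞ →
      ∫⁻ ω, prodOn X A (fun y => g y + ε * φ y) ω ∂P = K * pexp (ε * a) := by
    intro ε hε
    rw [lintegral_prodOn hX h hA hΛ (f := fun y => g y + ε * φ y) (hgm.add (hφm.const_mul ε)), lintegral_add_left hgm,
      lintegral_const_mul _ hφm, pexp_add,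
      ← lintegral_add_lintegral_one_sub (Λ := Λ) A hgm hg, nexp_add, ← ha]
    · calc _ = (pexp (∫⁻ y in A, g y ∂Λ) * nexp (∫⁻ y in A, g y ∂Λ)) * (K * pexp (ε * a)) := by ring
        _ = _ := by rw [pexp_mul_nexp (hle hg), one_mul]
    · exact fun y => ENNReal.add_ne_top.2 ⟨ne_top_of_le_ne_top ENNReal.one_ne_top (hg y),
        ENNReal.mul_ne_top hε (ne_top_of_le_ne_top ENNReal.one_ne_top (hφ y))⟩
  have hmQ : ∀ ε : ℝ≥0∞, Measurable (prodOn X A fun y => g y + ε * φ y) := fun ε =>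
    measurable_prodOn hX hA (hgm.add (hφm.const_mul ε))
  have hQ0 : ∫⁻ ω, prodOn X A g ω ∂P = K := by simpa using hQ 0 ENNReal.zero_ne_top
  have hlow : ∀ ε : ℝ≥0∞, ε ≠ ∞ → K + ε * ∫⁻ ω, D ω ∂P ≤ K * pexp (ε * a) := by
    intro ε hε
    rw [← hQ ε hε, ← hQ0, ← lintegral_const_mul _ hDm,
      ← lintegral_add_left (measurable_prodOn hX hA hgm)]
    refine lintegral_mono_ae ?_
    filter_upwards [ae_exists_finset hX h hA hΛ] with ω ⟨T, hT⟩
    rw [prodOn_eq hT, prodOn_eq hT, hDeq ω T hT]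
    exact add_le_prod_add_mul T (fun j => g (X j ω)) (fun j => φ (X j ω)) ε
  -- The remainder `K * pexp a` is the expected product at `ε = 1`.
  have hup : ∀ ε : ℝ≥0∞, ε ≤ 1 →
      K * pexp (ε * a) ≤ K + ε * ∫⁻ ω, D ω ∂P + ε ^ 2 * (K * pexp a) := by
    intro ε hε
    have h1 := hQ 1 ENNReal.one_ne_top
    simp only [one_mul] at h1
    rw [← hQ ε (ne_top_of_le_ne_top ENNReal.one_ne_top hε), ← h1, ← hQ0,
      ← lintegral_const_mul _ hDm, ← lintegral_const_mul,
      ← lintegral_add_left (measurable_prodOn hX hA hgm), ← lintegral_add_left]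
    · refine lintegral_mono_ae ?_
      filter_upwards [ae_exists_finset hX h hA hΛ] with ω ⟨T, hT⟩
      rw [prodOn_eq hT, prodOn_eq hT, prodOn_eq hT, hDeq ω T hT]
      exact prod_add_mul_le T (fun j => g (X j ω)) (fun j => φ (X j ω)) hε
    · exact (measurable_prodOn hX hA hgm).add (hDm.const_mul _)
    · exact measurable_prodOn hX hA (hgm.add hφm)
  have hat : a ≠ ∞ := hle hφ
  have hKt : K ≠ ∞ := nexp_ne_top _
  have hexp : ∀ ε : ℝ, 0 ≤ ε →
      pexp (ENNReal.ofReal ε * a) = ENNReal.ofReal (Real.exp (ε * a.toReal)) := by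
    intro ε hε
    rw [← ENNReal.ofReal_toReal hat, ← ENNReal.ofReal_mul hε, pexp_ofReal (by positivity),
      ENNReal.toReal_ofReal ENNReal.toReal_nonneg]
  have hpa : pexp a ≠ ∞ := by
    have := hexp 1 zero_le_one
    simp only [ENNReal.ofReal_one, one_mul] at this
    rw [this]; exact ENNReal.ofReal_ne_top
  -- Integrability of `D` comes for free from the lower bound at `ε = 1`.
  have hDt : ∫⁻ ω, D ω ∂P ≠ ∞ := by
    have := hlow 1 ENNReal.one_ne_top
    rw [one_mul, one_mul] at this
    exact ne_top_of_le_ne_top (ENNReal.mul_ne_top hKt hpa) (le_add_self.trans this)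
  rw [mul_comm, ← ENNReal.toReal_eq_toReal_iff' hDt (ENNReal.mul_ne_top hKt hat),
    ENNReal.toReal_mul]
  refine eq_mul_of_exp_bounds (M := (K * pexp a).toReal) (fun ε hε _ => ?_) (fun ε hε hε1 => ?_)
  · have h1 := hlow (ENNReal.ofReal ε) ENNReal.ofReal_ne_top
    rw [hexp ε hε.le] at h1
    have h2 := ENNReal.toReal_mono (ENNReal.mul_ne_top hKt ENNReal.ofReal_ne_top) h1
    rwa [ENNReal.toReal_add hKt (ENNReal.mul_ne_top ENNReal.ofReal_ne_top hDt), ENNReal.toReal_mul,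
      ENNReal.toReal_mul, ENNReal.toReal_ofReal hε.le,
      ENNReal.toReal_ofReal (Real.exp_pos _).le] at h2
  · have h1 := hup (ENNReal.ofReal ε) (by simpa using hε1)
    rw [hexp ε hε.le] at h1
    have h3 := ENNReal.add_ne_top.2 ⟨hKt, ENNReal.mul_ne_top (ENNReal.ofReal_ne_top (r := ε)) hDt⟩
    have h4 := ENNReal.mul_ne_top (ENNReal.pow_ne_top (n := 2) (ENNReal.ofReal_ne_top (r := ε)))
      (ENNReal.mul_ne_top hKt hpa)
    have h2 := ENNReal.toReal_mono (ENNReal.add_ne_top.2 ⟨h3, h4⟩) h1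
    rwa [ENNReal.toReal_add h3 h4,
      ENNReal.toReal_add hKt (ENNReal.mul_ne_top ENNReal.ofReal_ne_top hDt), ENNReal.toReal_mul,
      ENNReal.toReal_mul, ENNReal.toReal_mul (a := _ ^ 2), ENNReal.toReal_pow,
      ENNReal.toReal_ofReal hε.le, ENNReal.toReal_ofReal (Real.exp_pos _).le] at h2

omit [MeasurableSpace Ω] in
open Classical in
/-- Infinite products of a `[0, 1]`-valued function along a configuration are limits of the
products over the points in large balls. -/
lemma infProd_eq_iInf_ball (I : Set ℕ) (g : Plane → ℝ≥0∞) (hg : ∀ y, g y ≤ 1) (R₀ : ℕ) (ω : Ω) :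
    infProd (fun j => if j ∈ I then 1 else g (X j ω)) =
      ⨅ R : ℕ, infProd fun j => if j ∈ I then 1 else
        (Metric.ball 0 ((R₀ + R : ℕ) : ℝ)).piecewise g 1 (X j ω) := by
  refine le_antisymm (le_iInf fun R => infProd_mono fun j => ?_) (le_iInf fun F => ?_)
  · split_ifs
    · exact le_rfl
    · by_cases hj : X j ω ∈ Metric.ball (0 : Plane) ((R₀ + R : ℕ) : ℝ)
      · rw [Set.piecewise_eq_of_mem _ _ _ hj]
      · rw [Set.piecewise_eq_of_notMem _ _ _ hj]; exact hg _
  · obtain ⟨R, hR⟩ : ∃ R : ℕ, ∀ j ∈ F, X j ω ∈ Metric.ball (0 : Plane) ((R₀ + R : ℕ) : ℝ) := by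
      obtain ⟨R, hR⟩ := exists_nat_gt (∑ j ∈ F, ‖X j ω‖)
      refine ⟨R, fun j hj => ?_⟩
      have h1 : ‖X j ω‖ ≤ ∑ j ∈ F, ‖X j ω‖ :=
        Finset.single_le_sum (f := fun j => ‖X j ω‖) (fun _ _ => norm_nonneg _) hj
      have h2 : (0 : ℝ) ≤ R₀ := R₀.cast_nonneg
      rw [mem_ball_zero_iff]; push_cast; linarith
    refine (iInf_le _ R).trans ((infProd_le _ F).trans (le_of_eq ?_))
    refine Finset.prod_congr rfl fun j hj => ?_
    rw [Set.piecewise_eq_of_mem _ _ _ (hR j hj)]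

open Classical in
lemma antitone_infProd_ball (I : Set ℕ) (g : Plane → ℝ≥0∞) (hg : ∀ y, g y ≤ 1) (R₀ : ℕ)
    (x : ℕ → Plane) :
    Antitone fun R : ℕ => infProd fun j => if j ∈ I then 1 else
        (Metric.ball 0 ((R₀ + R : ℕ) : ℝ)).piecewise g 1 (x j) := by
  intro R R' hRR
  refine infProd_mono fun j => ?_
  split_ifs
  · exact le_rfl
  · by_cases hj : x j ∈ Metric.ball (0 : Plane) ((R₀ + R : ℕ) : ℝ)
    · have hj' : x j ∈ Metric.ball (0 : Plane) ((R₀ + R' : ℕ) : ℝ) :=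
        Metric.ball_subset_ball (by exact_mod_cast Nat.add_le_add_left hRR R₀) hj
      rw [Set.piecewise_eq_of_mem _ _ _ hj, Set.piecewise_eq_of_mem _ _ _ hj']
    · rw [Set.piecewise_eq_of_notMem _ _ _ hj]
      by_cases hj' : x j ∈ Metric.ball (0 : Plane) ((R₀ + R' : ℕ) : ℝ)
      · rw [Set.piecewise_eq_of_mem _ _ _ hj']; exact hg _
      · rw [Set.piecewise_eq_of_notMem _ _ _ hj']

lemma iSup_lintegral_ball (f : Plane → ℝ≥0∞) (R₀ : ℕ) :
    ⨆ R : ℕ, ∫⁻ y in Metric.ball 0 ((R₀ + R : ℕ) : ℝ), f y ∂Λ = ∫⁻ y, f y ∂Λ := by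
  have hmono : Monotone fun R : ℕ => Metric.ball (0 : Plane) ((R₀ + R : ℕ) : ℝ) := fun R R' h =>
    Metric.ball_subset_ball (by exact_mod_cast Nat.add_le_add_left h R₀)
  rw [← setLIntegral_iUnion_of_directed f (directed_of_isDirected_le hmono)]
  have : ⋃ R : ℕ, Metric.ball (0 : Plane) ((R₀ + R : ℕ) : ℝ) = Set.univ := by
    refine Set.eq_univ_of_forall fun y => ?_
    obtain ⟨R, hR⟩ := exists_nat_gt ‖y‖
    have h2 : (0 : ℝ) ≤ R₀ := R₀.cast_nonneg
    refine Set.mem_iUnion.2 ⟨R, ?_⟩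
    rw [mem_ball_zero_iff]; push_cast; linarith
  rw [this, Measure.restrict_univ]

lemma iInf_nexp_lintegral_ball (f : Plane → ℝ≥0∞) (R₀ : ℕ) :
    ⨅ R : ℕ, nexp (∫⁻ y in Metric.ball 0 ((R₀ + R : ℕ) : ℝ), f y ∂Λ) = nexp (∫⁻ y, f y ∂Λ) := by
  rw [← iSup_lintegral_ball (Λ := Λ) f R₀, nexp_anti.map_ciSup_of_continuousAt
    continuous_nexp.continuousAt]

/-- Probability generating functional of a Poisson process. -/
lemma lintegral_infProd [IsProbabilityMeasure P] [IsFiniteMeasureOnCompacts Λ]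
    (hX : ∀ j, Measurable (X j)) (h : IsPoissonProcess P Λ X)
    {g : Plane → ℝ≥0∞} (hgm : Measurable g) (hg : ∀ y, g y ≤ 1) :
    ∫⁻ ω, infProd (fun j => g (X j ω)) ∂P = nexp (∫⁻ y, (1 - g y) ∂Λ) := by
  classical
  have h0 : ∀ ω, infProd (fun j => g (X j ω)) = ⨅ R : ℕ, infProd fun j =>
      (Metric.ball 0 ((0 + R : ℕ) : ℝ)).piecewise g 1 (X j ω) := fun ω => by
    simpa using infProd_eq_iInf_ball (X := X) ∅ g hg 0 ω
  have hanti := fun x : ℕ → Plane => antitone_infProd_ball ∅ g hg 0 x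
  simp only [Set.mem_empty_iff_false, if_false] at hanti
  simp_rw [h0]
  rw [lintegral_iInf, ← iInf_nexp_lintegral_ball _ 0]
  · exact iInf_congr fun R => lintegral_infProd_piecewise hX h Metric.isOpen_ball.measurableSet
      measure_ball_lt_top.ne hgm hg
  · exact fun R => measurable_infProd fun j =>
      (Measurable.piecewise Metric.isOpen_ball.measurableSet hgm measurable_one).comp (hX j)
  · exact fun R R' hR ω => hanti (fun j => X j ω) hR
  · refine ne_top_of_le_ne_top ENNReal.one_ne_top ((lintegral_mono fun ω => infProd_le_one _).trans ?_)
    simp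

/-- Decreasing monotone convergence for the counting measure, where finiteness of the first sum
cannot be omitted. -/
lemma tsum_iInf_of_antitone {f : ℕ → ℕ → ℝ≥0∞} (hf : Antitone f) (h0 : ∑' i, f 0 i ≠ ∞) :
    ∑' i, ⨅ n, f n i = ⨅ n, ∑' i, f n i := by
  have := lintegral_iInf (μ := Measure.count) (fun n => (Measurable.of_discrete (f := f n))) hf
    (by rwa [lintegral_count])
  simpa [lintegral_count] using this

open Classical in
/-- Mecke formula for products along a Poisson process. -/
lemma lintegral_tsum_mul_infProd [IsProbabilityMeasure P] [IsFiniteMeasureOnCompacts Λ]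
    (hX : ∀ j, Measurable (X j)) (h : IsPoissonProcess P Λ X)
    {g φ : Plane → ℝ≥0∞} (hgm : Measurable g) (hg : ∀ y, g y ≤ 1)
    (hφm : Measurable φ) (hφ : ∀ y, φ y ≤ 1) {R₀ : ℕ} (hR₀ : ∀ y, (R₀ : ℝ) ≤ ‖y‖ → φ y = 0) :
    ∫⁻ ω, ∑' i, φ (X i ω) * infProd (fun j => if j = i then 1 else g (X j ω)) ∂P =
      (∫⁻ y, φ y ∂Λ) * nexp (∫⁻ y, (1 - g y) ∂Λ) := by
  -- All balls contain the support of `φ`, so only `g` is truncated as the radius grows.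
  set B : ℕ → Set Plane := fun R => Metric.ball (0 : Plane) ((R₀ + R : ℕ) : ℝ) with hB
  have hBm : ∀ R, MeasurableSet (B R) := fun R => Metric.isOpen_ball.measurableSet
  have hBΛ : ∀ R, Λ (B R) ≠ ∞ := fun R => measure_ball_lt_top.ne
  have hind : ∀ R, (B R).indicator φ = φ := fun R => by
    refine Set.indicator_eq_self.2 fun y hy => ?_
    by_contra hy'
    refine hy (hR₀ y ?_)
    rw [hB, mem_ball_zero_iff, not_lt] at hy'
    push_cast at hy'
    have : (0 : ℝ) ≤ R := R.cast_nonneg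
    linarith
  have hφint : ∀ R, ∫⁻ y in B R, φ y ∂Λ = ∫⁻ y, φ y ∂Λ := fun R => by
    rw [← lintegral_indicator (hBm R), hind R]
  have hφt : ∫⁻ y, φ y ∂Λ ≠ ∞ := by
    rw [← hφint 0]
    exact ne_top_of_le_ne_top (hBΛ 0) ((lintegral_mono hφ).trans (by simp))
  -- The case `g = 1` is Campbell's formula. It makes the sum of `φ` almost surely finite, which
  -- permits exchanging the sum with the decreasing limit of the truncated products.
  have hsum : ∫⁻ ω, ∑' i, φ (X i ω) ∂P = ∫⁻ y, φ y ∂Λ := by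
    have := lintegral_tsum_mul_infProd_piecewise hX h (hBm 0) (hBΛ 0) (g := 1) measurable_one
      (fun _ => le_rfl) hφm hφ
    have h2 : infProd (fun _ : ℕ => (1 : ℝ≥0∞)) = 1 := by
      simp [infProd]
    simpa [hind, hφint, Set.piecewise_same, h2] using this
  have hfin : ∀ᵐ ω ∂P, ∑' i, φ (X i ω) ≠ ∞ := by
    have hm : Measurable fun ω => ∑' i, φ (X i ω) := Measurable.tsum fun i => hφm.comp (hX i)
    filter_upwards [ae_lt_top hm (hsum ▸ hφt)] with ω hω using hω.ne
  set f : ℕ → ℕ → Ω → ℝ≥0∞ := fun R i ω =>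
    φ (X i ω) * infProd (fun j => if j = i then 1 else (B R).piecewise g 1 (X j ω)) with hf
  have hfanti : ∀ ω, Antitone fun R i => f R i ω := fun ω R R' hRR i => by
    have := antitone_infProd_ball {i} g hg R₀ (fun j => X j ω) hRR
    simp only [Set.mem_singleton_iff] at this
    exact mul_le_mul_right this _
  have hfle : ∀ R i ω, f R i ω ≤ φ (X i ω) := fun R i ω =>
    mul_le_of_le_one_right' (infProd_le_one _)
  have hfm : ∀ R i, Measurable (f R i) := fun R i => (hφm.comp (hX i)).mul
    (measurable_infProd fun j => by
      split_ifs
      · exact measurable_const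
      · exact (Measurable.piecewise (hBm R) hgm measurable_one).comp (hX j))
  have h1 : ∀ᵐ ω ∂P, ∑' i, φ (X i ω) * infProd (fun j => if j = i then 1 else g (X j ω)) =
      ⨅ R, ∑' i, f R i ω := by
    filter_upwards [hfin] with ω hω
    rw [← tsum_iInf_of_antitone (hfanti ω)
      (ne_top_of_le_ne_top hω (ENNReal.tsum_le_tsum fun i => hfle 0 i ω))]
    refine tsum_congr fun i => ?_
    have := infProd_eq_iInf_ball (X := X) {i} g hg R₀ ω
    simp only [Set.mem_singleton_iff] at this
    rw [this, ENNReal.mul_iInf fun h => absurd h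
      (ne_top_of_le_ne_top ENNReal.one_ne_top (hφ _))]
  rw [lintegral_congr_ae h1, lintegral_iInf (fun R => Measurable.tsum fun i => hfm R i)
    (fun R R' hRR ω => ENNReal.tsum_le_tsum (hfanti ω hRR))]
  · rw [← iInf_nexp_lintegral_ball _ R₀, ENNReal.mul_iInf fun h => absurd h hφt]
    · refine iInf_congr fun R => ?_
      have := lintegral_tsum_mul_infProd_piecewise hX h (hBm R) (hBΛ R) hgm hg hφm hφ
      rw [hind, hφint] at this
      exact this
  · refine ne_top_of_le_ne_top (hsum ▸ hφt) (lintegral_mono fun ω => ?_)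
    exact ENNReal.tsum_le_tsum fun i => hfle 0 i ω

end Mecke

/-! ### Several independent Poisson processes -/

section Positions

variable {ι Ω : Type*} [MeasurableSpace Ω] {P : Measure Ω} {X : ι → ℕ → Ω → Plane}

open Classical in
/-- Mecke formula for products over several independent Poisson processes. -/
lemma lintegral_tsum_mul_infProd_of_indep [Fintype ι] [IsProbabilityMeasure P]
    {Λ : ι → Measure Plane} [∀ m, IsFiniteMeasureOnCompacts (Λ m)]
    (hX : ∀ m j, Measurable (X m j)) (h : ∀ m, IsPoissonProcess P (Λ m) (X m))
    (hind : iIndepFun (fun (m : ι) (ω : Ω) (j : ℕ) => X m j ω) P)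
    {g : ι → Plane → ℝ≥0∞} (hgm : ∀ m, Measurable (g m)) (hg : ∀ m y, g m y ≤ 1)
    {φ : Plane → ℝ≥0∞} (hφm : Measurable φ) (hφ : ∀ y, φ y ≤ 1) {R₀ : ℕ}
    (hR₀ : ∀ y, (R₀ : ℝ) ≤ ‖y‖ → φ y = 0) (k : ι) :
    ∫⁻ ω, ∑' i, φ (X k i ω) *
        infProd (fun b : ι × ℕ => if b = (k, i) then 1 else g b.1 (X b.1 b.2 ω)) ∂P =
      (∫⁻ y, φ y ∂(Λ k)) * nexp (∑ m, ∫⁻ y, (1 - g m y) ∂(Λ m)) := by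
  -- The functional factors over the operators: operator `k` contributes the Mecke sum, every other
  -- operator a plain product. Independence then separates the expectations.
  let G : ι → (ℕ → Plane) → ℝ≥0∞ := fun m x =>
    if m = k then ∑' i, φ (x i) * infProd (fun j => if j = i then 1 else g m (x j))
    else infProd fun j => g m (x j)
  have hGm : ∀ m, Measurable (G m) := by
    intro m
    by_cases hm : m = k
    · simp only [G, hm, if_true]
      refine Measurable.tsum fun i => (hφm.comp (measurable_pi_apply i)).mul
        (measurable_infProd fun j => ?_)
      split_ifs
      · exact measurable_const
      · exact (hgm k).comp (measurable_pi_apply j)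
    · simp only [G, hm, if_false]
      exact measurable_infProd fun j => (hgm m).comp (measurable_pi_apply j)
  have h1 : ∀ ω, ∑' i, φ (X k i ω) *
      infProd (fun b : ι × ℕ => if b = (k, i) then 1 else g b.1 (X b.1 b.2 ω)) =
      ∏ m, G m fun j => X m j ω := by
    intro ω
    have h2 : ∀ i, infProd (fun b : ι × ℕ => if b = (k, i) then 1 else g b.1 (X b.1 b.2 ω)) =
        infProd (fun j => if j = i then 1 else g k (X k j ω)) *
          ∏ m ∈ Finset.univ.erase k, G m fun j => X m j ω := by
      intro i
      rw [infProd_prod, ← Finset.mul_prod_erase _ _ (Finset.mem_univ k)]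
      · congr 1
        · simp
        · refine Finset.prod_congr rfl fun m hm => ?_
          have hmk : m ≠ k := Finset.ne_of_mem_erase hm
          simp [G, hmk]
      · intro b; split_ifs
        · exact le_rfl
        · exact hg _ _
    simp_rw [h2, ← mul_assoc]
    rw [ENNReal.tsum_mul_right, ← Finset.mul_prod_erase _ _ (Finset.mem_univ k)]
    simp [G]
  simp_rw [h1]
  have hXm : ∀ m, Measurable fun (ω : Ω) (j : ℕ) => X m j ω := fun m =>
    measurable_pi_lambda _ fun j => hX m j
  rw [lintegral_prod_eq_prod_lintegral_of_indepFun Finset.univ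
    (fun m ω => G m fun j => X m j ω) (hind.comp G hGm) (fun m => (hGm m).comp (hXm m)),
    ← Finset.mul_prod_erase _ _ (Finset.mem_univ k),
    ← Finset.add_sum_erase _ _ (Finset.mem_univ k), nexp_add, nexp_sum, ← mul_assoc]
  congr 1
  · simp only [G, if_true]
    exact lintegral_tsum_mul_infProd (hX k) (h k) (hgm k) (hg k) hφm hφ hR₀
  · refine Finset.prod_congr rfl fun m hm => ?_
    have hmk : m ≠ k := Finset.ne_of_mem_erase hm
    simp only [G, hmk, if_false]
    exact lintegral_infProd (hX m) (h m) (hgm m) (hg m)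

end Positions

/-! ### Joint law of positions and marks -/

section Marks

/-- The type, the fading coefficient and the antenna angle of a station. -/
abbrev Mark : Type := LinkType × ℝ × ℝ

/-- Joint law of the mark of a station at distance `r`. -/
noncomputable def markLaw (β r : ℝ) : Measure Mark :=
  (typeLaw β r).prod ((expMeasure 1).prod angleLaw)

/-- A reference law for marks, not depending on the distance. -/
noncomputable def refMarkLaw : Measure Mark :=
  (((2 : ℝ≥0∞)⁻¹ • Measure.dirac LinkType.los + (2 : ℝ≥0∞)⁻¹ • Measure.dirac LinkType.nlos)).prod
    ((expMeasure 1).prod angleLaw)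

/-- Probability that a link of length `r` has a given type. -/
noncomputable def typeProb (β r : ℝ) : LinkType → ℝ≥0∞
  | .los => ENNReal.ofReal (Real.exp (-(β * r)))
  | .nlos => ENNReal.ofReal (1 - Real.exp (-(β * r)))

instance : IsProbabilityMeasure (expMeasure 1) := isProbabilityMeasure_expMeasure one_pos

instance : IsProbabilityMeasure angleLaw := by
  refine cond_isProbabilityMeasure_of_finite ?_ ?_ <;> simp [Real.pi_pos]

instance : IsFiniteMeasure
    ((2 : ℝ≥0∞)⁻¹ • Measure.dirac LinkType.los + (2 : ℝ≥0∞)⁻¹ • Measure.dirac LinkType.nlos) :=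
  ⟨by simp [ENNReal.inv_two_add_inv_two]⟩

instance : IsProbabilityMeasure refMarkLaw := by
  refine ⟨?_⟩
  rw [refMarkLaw, ← Set.univ_prod_univ, Measure.prod_prod]
  simp [ENNReal.inv_two_add_inv_two]

instance (β r : ℝ) : IsFiniteMeasure (typeLaw β r) := by
  refine ⟨?_⟩
  simp [typeLaw]

lemma lintegral_typeLaw (β r : ℝ) (f : LinkType → ℝ≥0∞) :
    ∫⁻ p, f p ∂(typeLaw β r) = typeProb β r .los * f .los + typeProb β r .nlos * f .nlos := by
  rw [typeLaw, lintegral_add_measure, lintegral_smul_measure, lintegral_smul_measure,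
    lintegral_dirac' _ measurable_from_top, lintegral_dirac' _ measurable_from_top]
  rfl

lemma measurable_linkType {α : Type*} [MeasurableSpace α] (f : LinkType → α → ℝ≥0∞)
    (hf : ∀ p, Measurable (f p)) : Measurable fun z : LinkType × α => f z.1 z.2 := by
  have : (fun z : LinkType × α => f z.1 z.2) = fun z =>
      ({LinkType.los} : Set LinkType).indicator (fun _ => 1) z.1 * f .los z.2 +
        ({LinkType.nlos} : Set LinkType).indicator (fun _ => 1) z.1 * f .nlos z.2 := by
    funext ⟨p, z⟩
    cases p <;> simp
  rw [this]
  have hm : ∀ p : LinkType, Measurable (({p} : Set LinkType).indicator (fun _ => (1 : ℝ≥0∞))) :=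
    fun p => measurable_from_top
  exact (((hm _).comp measurable_fst).mul ((hf _).comp measurable_snd)).add
    (((hm _).comp measurable_fst).mul ((hf _).comp measurable_snd))

lemma measurable_typeProb (β : ℝ) (p : LinkType) : Measurable fun r => typeProb β r p := by
  cases p <;> simp only [typeProb] <;> fun_prop

lemma measurable_uncurry_typeProb (β : ℝ) :
    Measurable fun z : LinkType × ℝ => typeProb β z.2 z.1 :=
  measurable_linkType (fun p r => typeProb β r p) (measurable_typeProb β)

/-- Relative to a fair choice between the two types, the type law at distance `r` has density `2 *
typeProb`. A fixed reference law turns the joint law of positions and marks into a product measure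
with a density, so that no transition kernel is needed. -/
lemma lintegral_markLaw (β r : ℝ) {f : Mark → ℝ≥0∞} (hf : Measurable f) :
    ∫⁻ z, f z ∂(markLaw β r) = ∫⁻ z, 2 * typeProb β r z.1 * f z ∂refMarkLaw := by
  have h1 : Measurable fun z : Mark => 2 * typeProb β r z.1 * f z :=
    (((measurable_uncurry_typeProb β).comp
      (measurable_fst.prodMk measurable_const)).const_mul 2).mul hf
  rw [markLaw, refMarkLaw, lintegral_prod _ hf.aemeasurable, lintegral_prod _ h1.aemeasurable,
    lintegral_typeLaw, lintegral_add_measure, lintegral_smul_measure, lintegral_smul_measure,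
    lintegral_dirac' _ measurable_from_top, lintegral_dirac' _ measurable_from_top]
  have h2 : ∀ p, ∫⁻ y : ℝ × ℝ, 2 * typeProb β r p * f (p, y) ∂((expMeasure 1).prod angleLaw) =
      2 * (typeProb β r p * ∫⁻ y : ℝ × ℝ, f (p, y) ∂((expMeasure 1).prod angleLaw)) := fun p => by
    rw [lintegral_const_mul _ (f := fun y => f (p, y)) (hf.comp (measurable_const.prodMk measurable_id)), mul_assoc]
  simp only [h2, smul_eq_mul]
  simp only [← mul_assoc, ENNReal.inv_mul_cancel two_ne_zero ENNReal.ofNat_ne_top, one_mul]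

lemma lintegral_pi_prod {β : Type*} [Fintype β] {M : Type*} [MeasurableSpace M]
    (μ : Measure M) [IsProbabilityMeasure μ] {f : β → M → ℝ≥0∞} (hf : ∀ b, Measurable (f b)) :
    ∫⁻ z, ∏ b, f b (z b) ∂(Measure.pi fun _ : β => μ) = ∏ b, ∫⁻ z, f b z ∂μ := by
  rw [lintegral_prod_eq_prod_lintegral_of_indepFun Finset.univ (fun b (z : β → M) => f b (z b))
    (iIndepFun_pi (X := f) fun b => (hf b).aemeasurable)
    (fun b => (hf b).comp (measurable_pi_apply b))]
  refine Finset.prod_congr rfl fun b _ => ?_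
  rw [← (measurePreserving_eval (fun _ : β => μ) b).lintegral_comp (hf b)]

variable {ι Ω : Type*} [MeasurableSpace Ω] {P : Measure Ω} {N : Params ι} {X : ι → ℕ → Ω → Plane}
  {s : ι → ℕ → Ω → LinkType} {h θ : ι → ℕ → Ω → ℝ}

/-- Density of the joint law of all positions and finitely many marks with respect to a product
measure. -/
noncomputable def markDensity (β : ℝ) (F : Finset (ι × ℕ)) (z : (ι → ℕ → Plane) × (F → Mark)) :
    ℝ≥0∞ :=
  ∏ b : F, 2 * typeProb β ‖z.1 b.1.1 b.1.2‖ (z.2 b).1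

lemma measurable_markDensity (β : ℝ) (F : Finset (ι × ℕ)) : Measurable (markDensity β F) := by
  refine Finset.measurable_fun_prod _ fun b _ => Measurable.const_mul ?_ 2
  refine (measurable_uncurry_typeProb β).comp (Measurable.prodMk ?_ ?_) <;> fun_prop

/-- By Tonelli the positions may be fixed first; then the density and the integrand both factor over
the stations, and the inner integral is a product. -/
lemma lintegral_withDensity_markDensity (β : ℝ) (F : Finset (ι × ℕ)) (Q : Measure (ι → ℕ → Plane))
    [IsProbabilityMeasure Q] {Φ : (ι → ℕ → Plane) → ℝ≥0∞} (hΦ : Measurable Φ)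
    {ψ : F → Plane × Mark → ℝ≥0∞} (hψ : ∀ b, Measurable (ψ b)) :
    ∫⁻ z, Φ z.1 * ∏ b : F, ψ b (z.1 b.1.1 b.1.2, z.2 b)
        ∂((Q.prod (Measure.pi fun _ : F => refMarkLaw)).withDensity (markDensity β F)) =
      ∫⁻ x, Φ x * ∏ b : F, ∫⁻ z, ψ b (x b.1.1 b.1.2, z) ∂(markLaw β ‖x b.1.1 b.1.2‖) ∂Q := by
  have hm : Measurable fun z : (ι → ℕ → Plane) × (F → Mark) =>
      Φ z.1 * ∏ b : F, ψ b (z.1 b.1.1 b.1.2, z.2 b) := by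
    refine (hΦ.comp measurable_fst).mul (Finset.measurable_fun_prod _ fun b _ => (hψ b).comp ?_)
    fun_prop
  rw [lintegral_withDensity_eq_lintegral_mul _ (measurable_markDensity β F) hm, lintegral_prod _
    ((measurable_markDensity β F).mul hm).aemeasurable]
  refine lintegral_congr fun x => ?_
  have h1 : ∀ b : F, Measurable fun z : Mark => ψ b (x b.1.1 b.1.2, z) := fun b =>
    (hψ b).comp (measurable_const.prodMk measurable_id)
  have h2 : ∀ b : F, Measurable fun z : Mark =>
      2 * typeProb β ‖x b.1.1 b.1.2‖ z.1 * ψ b (x b.1.1 b.1.2, z) := fun b =>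
    (((measurable_uncurry_typeProb β).comp
      (measurable_fst.prodMk measurable_const)).const_mul 2).mul (h1 b)
  simp only [Pi.mul_apply, markDensity]
  rw [Finset.prod_congr rfl fun b _ => lintegral_markLaw β _ (h1 b),
    ← lintegral_pi_prod refMarkLaw h2, ← lintegral_const_mul]
  · refine lintegral_congr fun z => ?_
    simp only [Finset.prod_mul_distrib]; ring
  · exact Finset.measurable_fun_prod _ fun b _ => (h2 b).comp (measurable_pi_apply b)

lemma IsDeployment.measurable_positions (hdep : IsDeployment N P X s h θ) :
    Measurable fun ω (m : ι) (j : ℕ) => X m j ω :=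
  measurable_pi_lambda _ fun m => measurable_pi_lambda _ fun j => hdep.meas_pos m j

lemma IsDeployment.measurable_marks (hdep : IsDeployment N P X s h θ) (b : ι × ℕ) :
    Measurable fun ω => (s b.1 b.2 ω, h b.1 b.2 ω, θ b.1 b.2 ω) :=
  (hdep.meas_type _ _).prodMk ((hdep.meas_fading _ _).prodMk (hdep.meas_angle _ _))

lemma markLaw_prod (β r : ℝ) (T : Set LinkType) (H Θ : Set ℝ) :
    markLaw β r (T ×ˢ H ×ˢ Θ) = typeLaw β r T * expMeasure 1 H * angleLaw Θ := by
  rw [markLaw, Measure.prod_prod, Measure.prod_prod, mul_assoc]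

/-- Joint law of all positions and finitely many marks. -/
lemma IsDeployment.map_eq [IsProbabilityMeasure P] (hdep : IsDeployment N P X s h θ)
    (F : Finset (ι × ℕ)) :
    P.map (fun ω => ((fun m j => X m j ω : ι → ℕ → Plane), fun b : F =>
        (s b.1.1 b.1.2 ω, h b.1.1 b.1.2 ω, θ b.1.1 b.1.2 ω))) =
      ((P.map fun ω m j => X m j ω).prod (Measure.pi fun _ : F => refMarkLaw)).withDensity
        (markDensity N.β F) := by
  classical
  have hXm := hdep.measurable_positions
  have : IsProbabilityMeasure (P.map fun ω m j => X m j ω) :=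
    Measure.isProbabilityMeasure_map hXm.aemeasurable
  have hm : Measurable fun ω => ((fun m j => X m j ω : ι → ℕ → Plane), fun b : F =>
      (s b.1.1 b.1.2 ω, h b.1.1 b.1.2 ω, θ b.1.1 b.1.2 ω)) :=
    hXm.prodMk (measurable_pi_lambda _ fun b => hdep.measurable_marks b.1)
  have : IsProbabilityMeasure (P.map (fun ω => ((fun m j => X m j ω : ι → ℕ → Plane), fun b : F =>
        (s b.1.1 b.1.2 ω, h b.1.1 b.1.2 ω, θ b.1.1 b.1.2 ω)))) :=
    Measure.isProbabilityMeasure_map hm.aemeasurable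
  have key : ∀ (A : Set (ι → ℕ → Plane)) (T : F → Set LinkType) (H Θ : F → Set ℝ),
      MeasurableSet A → (∀ b, MeasurableSet (T b)) → (∀ b, MeasurableSet (H b)) →
      (∀ b, MeasurableSet (Θ b)) →
      P.map (fun ω => ((fun m j => X m j ω : ι → ℕ → Plane), fun b : F =>
        (s b.1.1 b.1.2 ω, h b.1.1 b.1.2 ω, θ b.1.1 b.1.2 ω)))
          (A ×ˢ Set.univ.pi fun b => T b ×ˢ H b ×ˢ Θ b) =
      ((P.map fun ω m j => X m j ω).prod (Measure.pi fun _ : F => refMarkLaw)).withDensity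
        (markDensity N.β F) (A ×ˢ Set.univ.pi fun b => T b ×ˢ H b ×ˢ Θ b) := by
    intro A T H Θ hA hT hH hΘ
    have hS : MeasurableSet (A ×ˢ Set.univ.pi fun b : F => T b ×ˢ H b ×ˢ Θ b) :=
      hA.prod (MeasurableSet.univ_pi fun b => (hT b).prod ((hH b).prod (hΘ b)))
    -- The condition on marks in `IsDeployment` is stated for families indexed by all stations;
    -- outside of `F` they are filled with the whole space.
    let T' : ι × ℕ → Set LinkType := fun b => if hb : b ∈ F then T ⟨b, hb⟩ else Set.univ
    let H' : ι × ℕ → Set ℝ := fun b => if hb : b ∈ F then H ⟨b, hb⟩ else Set.univ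
    let Θ' : ι × ℕ → Set ℝ := fun b => if hb : b ∈ F then Θ ⟨b, hb⟩ else Set.univ
    have h1 := hdep.marks F A T' H' Θ' hA
      (fun b => by simp only [T']; split_ifs <;> simp)
      (fun b => by simp only [H']; split_ifs <;> simp [hH])
      (fun b => by simp only [Θ']; split_ifs <;> simp [hΘ])
    have h2 : (fun ω => ((fun m j => X m j ω : ι → ℕ → Plane), fun b : F =>
        (s b.1.1 b.1.2 ω, h b.1.1 b.1.2 ω, θ b.1.1 b.1.2 ω))) ⁻¹'
          (A ×ˢ Set.univ.pi fun b => T b ×ˢ H b ×ˢ Θ b) =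
        {ω | (fun m j => X m j ω) ∈ A ∧
          ∀ b ∈ F, s b.1 b.2 ω ∈ T' b ∧ h b.1 b.2 ω ∈ H' b ∧ θ b.1 b.2 ω ∈ Θ' b} := by
      ext ω
      simp only [Set.mem_preimage, Set.mem_prod, Set.mem_univ_pi, Set.mem_ofPred_eq]
      refine and_congr_right fun _ => ⟨fun hω b hb => ?_, fun hω b => ?_⟩
      · simpa [T', H', Θ', hb] using hω ⟨b, hb⟩
      · simpa [T', H', Θ', b.2] using hω b.1 b.2
    rw [Measure.map_apply hm hS, h2, h1, ← lintegral_indicator_one hS]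
    have hψ : ∀ b : F, Measurable fun z : Plane × Mark =>
        (T b ×ˢ H b ×ˢ Θ b).indicator (1 : Mark → ℝ≥0∞) z.2 := fun b =>
      (measurable_one.indicator ((hT b).prod ((hH b).prod (hΘ b)))).comp measurable_snd
    have h3 := lintegral_withDensity_markDensity N.β F (P.map fun ω m j => X m j ω)
      (measurable_one.indicator hA) hψ
    have h4 : ∀ z : (ι → ℕ → Plane) × (F → Mark),
        (A ×ˢ Set.univ.pi fun b => T b ×ˢ H b ×ˢ Θ b).indicator
          (1 : (ι → ℕ → Plane) × (F → Mark) → ℝ≥0∞) z =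
        A.indicator (1 : (ι → ℕ → Plane) → ℝ≥0∞) z.1 *
          ∏ b : F, (T b ×ˢ H b ×ˢ Θ b).indicator (1 : Mark → ℝ≥0∞) (z.2 b) := by
      intro z
      simp only [Set.indicator_apply, Pi.one_apply, Finset.prod_ite_zero, Set.mem_prod,
        Set.mem_univ_pi, Finset.mem_univ, true_implies]
      by_cases h5 : z.1 ∈ A <;> simp [h5]
    rw [lintegral_congr h4, h3, lintegral_map _ hXm]
    · have hA' : MeasurableSet {ω | (fun m j => X m j ω) ∈ A} := hXm hA
      rw [← lintegral_indicator hA']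
      refine lintegral_congr fun ω => ?_
      have h6 : ∀ b : F, ∫⁻ z, (T b ×ˢ H b ×ˢ Θ b).indicator (1 : Mark → ℝ≥0∞) z
          ∂(markLaw N.β ‖X b.1.1 b.1.2 ω‖) =
          typeLaw N.β ‖X b.1.1 b.1.2 ω‖ (T' b) * expMeasure 1 (H' b) * angleLaw (Θ' b) := by
        intro b
        rw [lintegral_indicator_one ((hT b).prod ((hH b).prod (hΘ b))), markLaw_prod]
        simp [T', H', Θ']
      simp only [h6]
      rw [Finset.prod_coe_sort F fun b =>
        typeLaw N.β ‖X b.1 b.2 ω‖ (T' b) * expMeasure 1 (H' b) * angleLaw (Θ' b)]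
      by_cases hω : (fun m j => X m j ω) ∈ A
      · rw [Set.indicator_of_mem hω, Set.indicator_of_mem (by exact hω)]; simp
      · rw [Set.indicator_of_notMem hω, Set.indicator_of_notMem (by exact hω)]; simp
    · refine (measurable_one.indicator hA).mul (Finset.measurable_fun_prod _ fun b _ => ?_)
      have h7 : ∀ x : ι → ℕ → Plane, ∫⁻ z, (T b ×ˢ H b ×ˢ Θ b).indicator (1 : Mark → ℝ≥0∞) z
          ∂(markLaw N.β ‖x b.1.1 b.1.2‖) =
          typeLaw N.β ‖x b.1.1 b.1.2‖ (T b) * expMeasure 1 (H b) * angleLaw (Θ b) := by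
        intro x
        rw [lintegral_indicator_one ((hT b).prod ((hH b).prod (hΘ b))), markLaw_prod]
      simp only [h7, ← lintegral_indicator_one (hT b), lintegral_typeLaw]
      have h8 : Measurable fun x : ι → ℕ → Plane => ‖x b.1.1 b.1.2‖ := by fun_prop
      have h9 : ∀ p, Measurable fun x : ι → ℕ → Plane => typeProb N.β ‖x b.1.1 b.1.2‖ p :=
        fun p => (measurable_typeProb _ p).comp h8
      exact ((((h9 _).mul_const _).fun_add ((h9 _).mul_const _)).mul_const _).mul_const _
  -- Boxes of type, fading and angle sets form a π-system generating the σ-algebra of marks. Hence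
  -- agreement on the boxes treated in `key`, including the whole space, identifies the two
  -- measures.
  let C₀ : Set (Set Mark) := Set.image2 (· ×ˢ ·) {T | MeasurableSet T}
    (Set.image2 (· ×ˢ ·) {H | MeasurableSet H} {Θ | MeasurableSet Θ})
  have hspan : IsCountablySpanning C₀ := isCountablySpanning_measurableSet.prod
    (isCountablySpanning_measurableSet.prod isCountablySpanning_measurableSet)
  have hgen : MeasurableSpace.generateFrom C₀ = (inferInstance : MeasurableSpace Mark) :=
    generateFrom_eq_prod MeasurableSpace.generateFrom_measurableSet generateFrom_prod
      isCountablySpanning_measurableSet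
      (isCountablySpanning_measurableSet.prod isCountablySpanning_measurableSet)
  have hpi : IsPiSystem C₀ := MeasurableSpace.isPiSystem_measurableSet.prod isPiSystem_prod
  have hC : ∀ S ∈ Set.image2 (· ×ˢ ·) {A : Set (ι → ℕ → Plane) | MeasurableSet A}
      (Set.pi Set.univ '' Set.pi Set.univ fun _ : F => C₀), ∃ A, ∃ T : F → Set LinkType,
      ∃ H Θ : F → Set ℝ, MeasurableSet A ∧ (∀ b, MeasurableSet (T b)) ∧
      (∀ b, MeasurableSet (H b)) ∧ (∀ b, MeasurableSet (Θ b)) ∧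
      S = A ×ˢ Set.univ.pi fun b => T b ×ˢ H b ×ˢ Θ b := by
    rintro _ ⟨A, hA, _, ⟨U, hU, rfl⟩, rfl⟩
    have : ∀ b, ∃ T H Θ, MeasurableSet T ∧ MeasurableSet H ∧ MeasurableSet Θ ∧
        U b = T ×ˢ H ×ˢ Θ := by
      intro b
      obtain ⟨T, hT, _, ⟨H, hH, Θ, hΘ, rfl⟩, hU'⟩ := hU b (Set.mem_univ b)
      exact ⟨T, H, Θ, hT, hH, hΘ, hU'.symm⟩
    choose T H Θ hT hH hΘ hU' using this
    refine ⟨A, T, H, Θ, hA, hT, hH, hΘ, ?_⟩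
    simp only [← hU']
  refine ext_of_generate_finite (Set.image2 (· ×ˢ ·) {A : Set (ι → ℕ → Plane) | MeasurableSet A}
      (Set.pi Set.univ '' Set.pi Set.univ fun _ : F => C₀)) ?_ ?_ ?_ ?_
  · refine (generateFrom_eq_prod MeasurableSpace.generateFrom_measurableSet
      (generateFrom_eq_pi (fun _ => hgen) fun _ => hspan) isCountablySpanning_measurableSet
      (IsCountablySpanning.pi fun _ => hspan)).symm
  · exact MeasurableSpace.isPiSystem_measurableSet.prod (IsPiSystem.pi fun _ => hpi)
  · intro S hS
    obtain ⟨A, T, H, Θ, hA, hT, hH, hΘ, rfl⟩ := hC S hS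
    exact key A T H Θ hA hT hH hΘ
  · simpa using key Set.univ (fun _ => Set.univ) (fun _ => Set.univ) (fun _ => Set.univ)
      MeasurableSet.univ (fun _ => MeasurableSet.univ) (fun _ => MeasurableSet.univ)
      (fun _ => MeasurableSet.univ)

/-- Marks can be integrated out one station at a time. -/
lemma IsDeployment.lintegral_prod_marks [IsProbabilityMeasure P] (hdep : IsDeployment N P X s h θ)
    (F : Finset (ι × ℕ)) {ψ : ι × ℕ → Plane × Mark → ℝ≥0∞} (hψ : ∀ b, Measurable (ψ b))
    (hψ' : ∀ b, Measurable fun x => ∫⁻ z, ψ b (x, z) ∂(markLaw N.β ‖x‖)) :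
    ∫⁻ ω, ∏ b ∈ F, ψ b (X b.1 b.2 ω, s b.1 b.2 ω, h b.1 b.2 ω, θ b.1 b.2 ω) ∂P =
      ∫⁻ ω, ∏ b ∈ F, ∫⁻ z, ψ b (X b.1 b.2 ω, z) ∂(markLaw N.β ‖X b.1 b.2 ω‖) ∂P := by
  have hXm := hdep.measurable_positions
  have : IsProbabilityMeasure (P.map fun ω m j => X m j ω) :=
    Measure.isProbabilityMeasure_map hXm.aemeasurable
  have hm : Measurable fun ω => ((fun m j => X m j ω : ι → ℕ → Plane), fun b : F =>
      (s b.1.1 b.1.2 ω, h b.1.1 b.1.2 ω, θ b.1.1 b.1.2 ω)) :=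
    hXm.prodMk (measurable_pi_lambda _ fun b => hdep.measurable_marks b.1)
  have h1 := lintegral_withDensity_markDensity N.β F (P.map fun ω m j => X m j ω)
    (Φ := 1) measurable_one (ψ := fun b => ψ b.1) (fun b => hψ b.1)
  rw [← hdep.map_eq F, lintegral_map _ hm, lintegral_map _ hXm] at h1
  · simp only [Pi.one_apply, one_mul] at h1
    simp only [← Finset.prod_coe_sort F]
    exact h1
  · refine measurable_one.mul (Finset.measurable_fun_prod _ fun b _ => ?_)
    exact (hψ' b.1).comp (by fun_prop : Measurable fun x : ι → ℕ → Plane => x b.1.1 b.1.2)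
  · refine (measurable_one.comp measurable_fst).mul (Finset.measurable_fun_prod _ fun b _ =>
      (hψ b.1).comp ?_)
    fun_prop

end Marks

/-! ### Polar coordinates -/

lemma lintegral_comp_norm_plane {f : ℝ → ℝ≥0∞} (hf : Measurable f) :
    ∫⁻ y : Plane, f ‖y‖ = ∫⁻ r in Set.Ioi (0 : ℝ), ENNReal.ofReal (2 * Real.pi * r) * f r := by
  have hdim : Module.finrank ℝ Plane = 2 := by simp
  -- The mass of the unit circle is the dimension `2` times the area `π` of the unit disc.
  have hsphere : (volume : Measure Plane).toSphere Set.univ = ENNReal.ofReal (2 * Real.pi) := by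
    rw [Measure.toSphere_apply_univ, hdim, EuclideanSpace.volume_ball_fin_two,
      ENNReal.ofReal_mul zero_le_two]
    simp
  have hfr : Measurable fun r : Set.Ioi (0 : ℝ) => f r := hf.comp measurable_subtype_coe
  have hfp : Measurable fun z : Metric.sphere (0 : Plane) 1 × Set.Ioi (0 : ℝ) => f z.2 :=
    hfr.comp measurable_snd
  calc ∫⁻ y : Plane, f ‖y‖
      = ∫⁻ y : ({(0 : Plane)}ᶜ : Set Plane), f ‖y.1‖ ∂((volume : Measure Plane).comap (↑)) := by
        rw [lintegral_subtype_comap (measurableSet_singleton _).compl fun y : Plane => f ‖y‖,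
          restrict_compl_singleton]
    _ = ∫⁻ z, f z.2 ∂((volume : Measure Plane).toSphere.prod (.volumeIoiPow 1)) := by
        have h := (volume : Measure Plane).measurePreserving_homeomorphUnitSphereProd
        rw [hdim] at h
        rw [← h.lintegral_comp hfp]
        simp
    _ = ENNReal.ofReal (2 * Real.pi) * ∫⁻ r : Set.Ioi (0 : ℝ), f r ∂(.volumeIoiPow 1) := by
        rw [lintegral_prod _ hfp.aemeasurable]
        simp only [lintegral_const]
        rw [hsphere, mul_comm]
    _ = _ := by
        rw [Measure.volumeIoiPow, lintegral_withDensity_eq_lintegral_mul _ (by fun_prop) hfr,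
          ← lintegral_const_mul _ (by fun_prop),
          ← lintegral_subtype_comap measurableSet_Ioi]
        refine lintegral_congr fun r => ?_
        have : (0 : ℝ) ≤ r := r.2.le
        simp only [Pi.mul_apply, pow_one]
        rw [ENNReal.ofReal_mul (p := 2 * Real.pi) (by positivity), mul_assoc]

/-! ### Comparison of measures on the line -/

/-- On a cell `[x, y)` the excess of `m₁` over `m₂` is at most `(f x - f y) * ν [x, y) ≤ (f x - f y)
* δ`. Summing over the cells telescopes to `(f a - f (a + n η)) * δ`; the statement is arranged
without subtraction. -/
lemma add_le_of_sandwich_grid {m₁ m₂ ν : Measure ℝ} {f : ℝ → ℝ≥0∞} (hf : Antitone f)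
    (h₁ : ∀ a b, a < b → m₁ (Set.Ico a b) ≤ f a * ν (Set.Ico a b))
    (h₂ : ∀ a b, a < b → f b * ν (Set.Ico a b) ≤ m₂ (Set.Ico a b))
    {a η : ℝ} (hη : 0 < η) {δ : ℝ≥0∞} (n : ℕ)
    (hδ : ∀ i < n, ν (Set.Ico (a + i * η) (a + (i + 1 : ℕ) * η)) ≤ δ) :
    m₁ (Set.Ico a (a + n * η)) + f (a + n * η) * δ ≤ m₂ (Set.Ico a (a + n * η)) + f a * δ := by
  induction n with
  | zero => simp
  | succ n ih =>
    have hlt : a + n * η < a + (n + 1 : ℕ) * η := by push_cast; linarith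
    have hle : a ≤ a + n * η := by have : 0 ≤ n * η := by positivity
                                   linarith
    have hsplit : ∀ m : Measure ℝ, m (Set.Ico a (a + (n + 1 : ℕ) * η)) =
        m (Set.Ico a (a + n * η)) + m (Set.Ico (a + n * η) (a + (n + 1 : ℕ) * η)) := by
      intro m
      rw [← measure_union (Set.Ico_disjoint_Ico_same) measurableSet_Ico,
        Set.Ico_union_Ico_eq_Ico hle hlt.le]
    have ih' := ih fun i hi => hδ i (hi.trans n.lt_succ_self)
    have h1 := h₁ _ _ hlt
    have h2 := h₂ _ _ hlt
    have h3 := hδ n n.lt_succ_self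
    rw [hsplit m₁, hsplit m₂]
    set x := a + n * η
    set y := a + (n + 1 : ℕ) * η
    set ν' := ν (Set.Ico x y)
    obtain ⟨d, hd⟩ := exists_add_of_le (hf hlt.le)
    obtain ⟨e, he⟩ := exists_add_of_le h3
    -- This is `(f x - f y) * (δ - ν') ≥ 0`, with `d` and `e` standing for the two differences.
    have key : f x * ν' + f y * δ ≤ f y * ν' + f x * δ := by
      calc f x * ν' + f y * δ = f y * ν' + d * ν' + f y * (ν' + e) := by rw [hd, he]; ring
        _ ≤ f y * ν' + d * ν' + f y * (ν' + e) + d * e := le_self_add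
        _ = _ := by rw [hd, he]; ring
    calc _ = m₁ (Set.Ico a x) + (m₁ (Set.Ico x y) + f y * δ) := by ring
      _ ≤ m₁ (Set.Ico a x) + (f x * ν' + f y * δ) := by gcongr
      _ ≤ m₁ (Set.Ico a x) + (f y * ν' + f x * δ) := by gcongr
      _ ≤ m₁ (Set.Ico a x) + (m₂ (Set.Ico x y) + f x * δ) := by gcongr
      _ = (m₁ (Set.Ico a x) + f x * δ) + m₂ (Set.Ico x y) := by ring
      _ ≤ (m₂ (Set.Ico a x) + f a * δ) + m₂ (Set.Ico x y) := by gcongr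
      _ = _ := by ring

/-- With `n + 1` equal cells the telescoped error is at most `C * (b - a) / (n + 1)`, which tends to
zero. The Lipschitz bound on `ν` supplies the common cell bound. -/
lemma le_of_sandwich {m₁ m₂ ν : Measure ℝ} {f : ℝ → ℝ≥0∞} (hf : Antitone f) (hf1 : ∀ x, f x ≤ 1)
    (h₁ : ∀ a b, a < b → m₁ (Set.Ico a b) ≤ f a * ν (Set.Ico a b))
    (h₂ : ∀ a b, a < b → f b * ν (Set.Ico a b) ≤ m₂ (Set.Ico a b))
    (hν : ∀ b : ℝ, ∃ C : ℝ, 0 ≤ C ∧ ∀ x y, x ≤ y → y ≤ b →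
      ν (Set.Ico x y) ≤ ENNReal.ofReal (C * (y - x))) {a b : ℝ} (hab : a < b) :
    m₁ (Set.Ico a b) ≤ m₂ (Set.Ico a b) := by
  obtain ⟨C, hC0, hC⟩ := hν b
  have hn : ∀ n : ℕ, m₁ (Set.Ico a b) ≤
      m₂ (Set.Ico a b) + ENNReal.ofReal (C * ((b - a) / (n + 1 : ℕ))) := by
    intro n
    have hn0 : (0 : ℝ) < (n + 1 : ℕ) := by positivity
    have hη : 0 < (b - a) / (n + 1 : ℕ) := div_pos (sub_pos.2 hab) hn0
    have hend : a + (n + 1 : ℕ) * ((b - a) / (n + 1 : ℕ)) = b := by field_simp; ring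
    have := add_le_of_sandwich_grid hf h₁ h₂ (a := a) hη (n + 1)
      (δ := ENNReal.ofReal (C * ((b - a) / (n + 1 : ℕ)))) fun i hi => by
        set η := (b - a) / (n + 1 : ℕ)
        refine (hC _ _ ?_ ?_).trans (le_of_eq ?_)
        · push_cast; linarith
        · conv_rhs => rw [← hend]
          have : ((i + 1 : ℕ) : ℝ) ≤ (n + 1 : ℕ) := by exact_mod_cast hi
          gcongr
        · congr 2; push_cast; ring
    rw [hend] at this
    refine le_self_add.trans (this.trans ?_)
    gcongr
    exact mul_le_of_le_one_left' (hf1 a)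
  have hlim : Tendsto (fun n : ℕ => m₂ (Set.Ico a b) +
      ENNReal.ofReal (C * ((b - a) / (n + 1 : ℕ)))) atTop (𝓝 (m₂ (Set.Ico a b) + 0)) := by
    refine Tendsto.const_add _ ?_
    rw [← ENNReal.ofReal_zero]
    refine ENNReal.tendsto_ofReal ?_
    rw [← mul_zero C]
    refine Tendsto.const_mul C ?_
    exact (tendsto_const_div_atTop_nhds_zero_nat (b - a)).comp (tendsto_add_atTop_nat 1)
  rw [add_zero] at hlim
  exact ge_of_tendsto' hlim hn

/-- A measure squeezed between `f b • ν` and `f a • ν` on `[a, b)`, for a decreasing `f` and a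
diffuse `ν`, has density `f` with respect to `ν`. -/
lemma eq_withDensity_of_sandwich {μ ν : Measure ℝ} [IsLocallyFiniteMeasure μ] {f : ℝ → ℝ≥0∞}
    (hf : Antitone f) (hf1 : ∀ x, f x ≤ 1)
    (h₁ : ∀ a b, a < b → μ (Set.Ico a b) ≤ f a * ν (Set.Ico a b))
    (h₂ : ∀ a b, a < b → f b * ν (Set.Ico a b) ≤ μ (Set.Ico a b))
    (hν : ∀ b : ℝ, ∃ C : ℝ, 0 ≤ C ∧ ∀ x y, x ≤ y → y ≤ b →
      ν (Set.Ico x y) ≤ ENNReal.ofReal (C * (y - x))) :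
    μ = ν.withDensity f := by
  -- The candidate `ν.withDensity f` satisfies the same two bounds as `μ`, so the comparison applies
  -- in both directions.
  have g₁ : ∀ a b, a < b → ν.withDensity f (Set.Ico a b) ≤ f a * ν (Set.Ico a b) := by
    intro a b _
    rw [withDensity_apply _ measurableSet_Ico, ← setLIntegral_const]
    exact setLIntegral_mono measurable_const fun x hx => hf hx.1
  have g₂ : ∀ a b, a < b → f b * ν (Set.Ico a b) ≤ ν.withDensity f (Set.Ico a b) := by
    intro a b _
    rw [withDensity_apply _ measurableSet_Ico, ← setLIntegral_const]
    exact setLIntegral_mono hf.measurable fun x hx => hf hx.2.le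
  refine Measure.ext_of_Ico _ _ fun a b hab => le_antisymm ?_ ?_
  · exact le_of_sandwich hf hf1 h₁ g₂ hν hab
  · exact le_of_sandwich hf hf1 g₁ h₂ hν hab

/-! ### Fading and antenna gain -/

/-- The integrand `exp (-a η) * exp (-η)` is `1 / (1 + a)` times the exponential density of rate `1
+ a`. Negative `η`, where `ENNReal.ofReal` truncates, carry no mass. -/
lemma lintegral_nexp_expMeasure {a : ℝ} (ha : 0 ≤ a) :
    ∫⁻ η, nexp (ENNReal.ofReal (a * η)) ∂(expMeasure 1) = ENNReal.ofReal (1 / (1 + a)) := by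
  have h1a : 0 < 1 + a := by linarith
  have hpdf : ∀ r : ℝ, Measurable (exponentialPDF r) := fun r =>
    (measurable_exponentialPDFReal r).ennreal_ofReal
  have hdef : expMeasure 1 = volume.withDensity (exponentialPDF 1) := rfl
  have hm : Measurable fun η : ℝ => nexp (ENNReal.ofReal (a * η)) :=
    measurable_nexp.comp (by fun_prop)
  rw [hdef, lintegral_withDensity_eq_lintegral_mul _ (hpdf 1) hm]
  have h2 : ∀ η, (exponentialPDF 1 * fun η => nexp (ENNReal.ofReal (a * η))) η =
      ENNReal.ofReal (1 / (1 + a)) * exponentialPDF (1 + a) η := by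
    intro η
    rw [Pi.mul_apply, exponentialPDF_eq, exponentialPDF_eq]
    split_ifs with hη
    · rw [nexp_ofReal (by positivity), ← ENNReal.ofReal_mul (by positivity),
        ← ENNReal.ofReal_mul (by positivity)]
      congr 1
      rw [mul_assoc, ← Real.exp_add, ← mul_assoc, one_div, inv_mul_cancel₀ h1a.ne']
      congr 2; ring
    · simp
  rw [lintegral_congr h2, lintegral_const_mul _ (hpdf _), lintegral_exponentialPDF_eq_one h1a,
    mul_one]

lemma angleLaw_main_lobe {b : ℝ} (hb' : b ≤ Real.pi) :
    angleLaw {φ | |φ| < b} = ENNReal.ofReal (b / Real.pi) := by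
  have h1 : {φ : ℝ | |φ| < b} = Set.Ioo (-b) b := by ext; simp [abs_lt]
  have hpi := Real.pi_pos
  rw [angleLaw, cond_apply measurableSet_Ioo, h1, Set.inter_eq_right.2
    (Set.Ioo_subset_Ioo (neg_le_neg hb') hb'), Real.volume_Ioo, Real.volume_Ioo,
    ← ENNReal.ofReal_inv_of_pos (by linarith),
    ← ENNReal.ofReal_mul (inv_nonneg.2 (by linarith))]
  congr 1
  field_simp

lemma angleLaw_side_lobe {b : ℝ} (hb : 0 ≤ b) (hb' : b ≤ Real.pi) :
    angleLaw {φ | ¬ |φ| < b} = ENNReal.ofReal ((Real.pi - b) / Real.pi) := by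
  have hm : MeasurableSet {φ : ℝ | |φ| < b} := measurableSet_lt (by fun_prop) measurable_const
  have hpi := Real.pi_pos
  have : {φ : ℝ | ¬ |φ| < b} = {φ : ℝ | |φ| < b}ᶜ := rfl
  rw [this, prob_compl_eq_one_sub hm, angleLaw_main_lobe hb', ← ENNReal.ofReal_one,
    ← ENNReal.ofReal_sub _ (div_nonneg hb hpi.le)]
  congr 1
  field_simp

variable {ι : Type*}

lemma measurable_antenna (N : Params ι) : Measurable (antenna N) := by
  unfold antenna
  exact Measurable.ite (measurableSet_lt (by fun_prop) measurable_const) measurable_const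
    measurable_const

/-- The antenna gain is constant on each of the two lobes, so `f` needs no measurability. -/
lemma lintegral_antenna (N : Params ι) (f : ℝ → ℝ≥0∞) :
    ∫⁻ φ, f (antenna N φ) ∂angleLaw = ENNReal.ofReal (N.θb / Real.pi) * f N.G₁ +
      ENNReal.ofReal ((Real.pi - N.θb) / Real.pi) * f N.G₂ := by
  have hm : MeasurableSet {φ : ℝ | |φ| < N.θb} := measurableSet_lt (by fun_prop) measurable_const
  rw [← lintegral_add_compl _ hm, setLIntegral_congr_fun (g := fun _ => f N.G₁) hm,
    setLIntegral_congr_fun (g := fun _ => f N.G₂) hm.compl, setLIntegral_const, setLIntegral_const,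
    angleLaw_main_lobe N.θb_le_pi, mul_comm, mul_comm (f N.G₂)]
  · congr 2
    exact angleLaw_side_lobe N.θb_nonneg N.θb_le_pi
  · intro φ hφ
    simp only [Set.mem_compl_iff, Set.mem_ofPred_eq] at hφ
    simp [antenna, hφ]
  · intro φ hφ
    simp only [Set.mem_ofPred_eq] at hφ
    simp [antenna, hφ]

lemma antenna_nonneg (N : Params ι) (φ : ℝ) : 0 ≤ antenna N φ := by
  unfold antenna; split_ifs
  exacts [N.G₁_nonneg, N.G₂_nonneg]

/-- Laplace transform of the power received from one interferer, if the average received power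
without antenna gain, multiplied with the argument of the transform, is `c`. -/
noncomputable def fadingLaplace (N : Params ι) (c : ℝ) : ℝ≥0∞ :=
  ENNReal.ofReal (N.θb / Real.pi) * ENNReal.ofReal (1 / (1 + c * N.G₁)) +
    ENNReal.ofReal ((Real.pi - N.θb) / Real.pi) * ENNReal.ofReal (1 / (1 + c * N.G₂))

/-- The complement of `fadingLaplace` to one. -/
noncomputable def fadingLoss (N : Params ι) (c : ℝ) : ℝ≥0∞ :=
  ENNReal.ofReal (N.θb / Real.pi) * ENNReal.ofReal (c * N.G₁ / (1 + c * N.G₁)) +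
    ENNReal.ofReal ((Real.pi - N.θb) / Real.pi) * ENNReal.ofReal (c * N.G₂ / (1 + c * N.G₂))

lemma fadingLaplace_add_fadingLoss (N : Params ι) {c : ℝ} (hc : 0 ≤ c) :
    fadingLaplace N c + fadingLoss N c = 1 := by
  have h1 : ∀ G : ℝ, 0 ≤ G → ENNReal.ofReal (1 / (1 + c * G)) +
      ENNReal.ofReal (c * G / (1 + c * G)) = 1 := fun G hG => by
    have : 0 < 1 + c * G := by positivity
    rw [← ENNReal.ofReal_add (by positivity) (by positivity), ← add_div, div_self this.ne',
      ENNReal.ofReal_one]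
  have hpi := Real.pi_pos
  have h2 : 0 ≤ (Real.pi - N.θb) / Real.pi := div_nonneg (sub_nonneg.2 N.θb_le_pi) hpi.le
  calc fadingLaplace N c + fadingLoss N c =
      ENNReal.ofReal (N.θb / Real.pi) * (ENNReal.ofReal (1 / (1 + c * N.G₁)) +
        ENNReal.ofReal (c * N.G₁ / (1 + c * N.G₁))) +
      ENNReal.ofReal ((Real.pi - N.θb) / Real.pi) * (ENNReal.ofReal (1 / (1 + c * N.G₂)) +
        ENNReal.ofReal (c * N.G₂ / (1 + c * N.G₂))) := by
        rw [fadingLaplace, fadingLoss]; ring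
    _ = 1 := by
        rw [h1 _ N.G₁_nonneg, h1 _ N.G₂_nonneg, mul_one, mul_one,
          ← ENNReal.ofReal_add (div_nonneg N.θb_nonneg hpi.le) h2, ← add_div,
          add_sub_cancel, div_self hpi.ne', ENNReal.ofReal_one]

lemma lintegral_fading_antenna (N : Params ι) {c : ℝ} (hc : 0 ≤ c) :
    ∫⁻ z : ℝ × ℝ, nexp (ENNReal.ofReal (c * antenna N z.2 * z.1)) ∂((expMeasure 1).prod angleLaw) =
      fadingLaplace N c := by
  have hm : Measurable fun z : ℝ × ℝ => nexp (ENNReal.ofReal (c * antenna N z.2 * z.1)) := by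
    have := measurable_antenna N
    exact measurable_nexp.comp (by fun_prop)
  rw [lintegral_prod_symm _ hm.aemeasurable]
  have h1 : ∀ φ, ∫⁻ η, nexp (ENNReal.ofReal (c * antenna N φ * η)) ∂(expMeasure 1) =
      ENNReal.ofReal (1 / (1 + c * antenna N φ)) := fun φ =>
    lintegral_nexp_expMeasure (mul_nonneg hc (antenna_nonneg N φ))
  simp only [h1]
  rw [lintegral_antenna N fun G => ENNReal.ofReal (1 / (1 + c * G))]
  rfl

/-- This lets an indicator attached to one distinguished station act as that station's factor in the
product, so that all marks can be integrated out at once. -/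
lemma infProd_ite_eq {β : Type*} [DecidableEq β] (b₀ : β) {c : ℝ≥0∞} (hc : c ≤ 1) {v : β → ℝ≥0∞}
    (hv : ∀ b, v b ≤ 1) :
    infProd (fun b => if b = b₀ then c else v b) =
      c * infProd (fun b => if b = b₀ then 1 else v b) := by
  have h1 : ∀ b, (if b = b₀ then c else v b) =
      (if b = b₀ then c else 1) * (if b = b₀ then 1 else v b) := by
    intro b; split_ifs <;> simp
  have h2 : infProd (fun b => if b = b₀ then c else 1) = c := by
    rw [infProd_eq_prod (F := {b₀})]
    · simp
    · intro b; split_ifs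
      · exact hc
      · exact le_rfl
    · intro b hb
      simp only [Finset.mem_singleton] at hb
      simp [hb]
  simp_rw [h1]
  rw [infProd_mul, h2]
  · intro b; split_ifs
    · exact hc
    · exact le_rfl
  · intro b; split_ifs
    · exact le_rfl
    · exact hv b

/-! ### Integrating out the marks, and the Mecke formula for marked stations -/

section Frozen

lemma typeProb_add {β r : ℝ} (h : 0 ≤ β * r) : typeProb β r .los + typeProb β r .nlos = 1 := by
  have : Real.exp (-(β * r)) ≤ 1 := Real.exp_le_one_iff.2 (neg_nonpos.2 h)
  rw [typeProb, typeProb, ← ENNReal.ofReal_add (Real.exp_pos _).le (sub_nonneg.2 this)]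
  simp

lemma typeProb_le_one {β r : ℝ} (h : 0 ≤ β * r) (p : LinkType) : typeProb β r p ≤ 1 := by
  rw [← typeProb_add h]
  cases p
  · exact le_self_add
  · exact le_add_self

lemma markLaw_univ {β r : ℝ} (h : 0 ≤ β * r) : markLaw β r Set.univ = 1 := by
  have h1 := lintegral_typeLaw β r 1
  simp only [Pi.one_apply, lintegral_one, mul_one, typeProb_add h] at h1
  rw [← Set.univ_prod_univ, ← Set.univ_prod_univ, markLaw_prod, h1]
  simp

lemma lintegral_markLaw_le_one {β r : ℝ} (h : 0 ≤ β * r) {f : Mark → ℝ≥0∞} (hf : ∀ z, f z ≤ 1) :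
    ∫⁻ z, f z ∂(markLaw β r) ≤ 1 :=
  (lintegral_mono hf).trans (by simp [markLaw_univ h])

/-- The integrating measure varies with `x`; rewritten against the reference law this becomes an
ordinary parameter integral. -/
lemma measurable_lintegral_markLaw (β : ℝ) {ψ : Plane × Mark → ℝ≥0∞} (hψ : Measurable ψ) :
    Measurable fun x => ∫⁻ z, ψ (x, z) ∂(markLaw β ‖x‖) := by
  have h1 : ∀ x, ∫⁻ z, ψ (x, z) ∂(markLaw β ‖x‖) =
      ∫⁻ z, 2 * typeProb β ‖x‖ z.1 * ψ (x, z) ∂refMarkLaw := fun x =>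
    lintegral_markLaw β _ (hψ.comp (measurable_const.prodMk measurable_id))
  simp_rw [h1]
  refine Measurable.lintegral_prod_right' (f := fun z : Plane × Mark =>
    2 * typeProb β ‖z.1‖ z.2.1 * ψ z) ?_
  refine Measurable.mul (Measurable.const_mul ?_ 2) hψ
  exact (measurable_uncurry_typeProb β).comp (Measurable.prodMk (by fun_prop) (by fun_prop))

lemma lintegral_markLaw_eq (β r : ℝ) {f : Mark → ℝ≥0∞} (hf : Measurable f) :
    ∫⁻ z, f z ∂(markLaw β r) =
      typeProb β r .los * ∫⁻ z, f (.los, z) ∂((expMeasure 1).prod angleLaw) +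
        typeProb β r .nlos * ∫⁻ z, f (.nlos, z) ∂((expMeasure 1).prod angleLaw) := by
  rw [markLaw, lintegral_prod _ hf.aemeasurable, lintegral_typeLaw]

variable {ι Ω : Type*} [MeasurableSpace Ω] {P : Measure Ω} {N : Params ι} {X : ι → ℕ → Ω → Plane}
  {s : ι → ℕ → Ω → LinkType} {h θ : ι → ℕ → Ω → ℝ}

/-- Intensity measure of the stations of an operator. -/
noncomputable def intensity (N : Params ι) (m : ι) : Measure Plane :=
  ENNReal.ofReal (N.density m) • volume

instance (N : Params ι) (m : ι) : IsFiniteMeasureOnCompacts (intensity N m) :=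
  ⟨fun _ hK => ENNReal.mul_lt_top ENNReal.ofReal_lt_top hK.measure_lt_top⟩

/-- Marks are integrated out of every finite subproduct; both sides are the infima of these finite
expectations. -/
lemma IsDeployment.lintegral_infProd_marks [IsProbabilityMeasure P] [Countable ι]
    (hdep : IsDeployment N P X s h θ)
    {ψ : ι × ℕ → Plane × Mark → ℝ≥0∞} (hψ : ∀ b, Measurable (ψ b)) (hψ1 : ∀ b z, ψ b z ≤ 1) :
    ∫⁻ ω, infProd (fun b => ψ b (X b.1 b.2 ω, s b.1 b.2 ω, h b.1 b.2 ω, θ b.1 b.2 ω)) ∂P =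
      ∫⁻ ω, infProd (fun b => ∫⁻ z, ψ b (X b.1 b.2 ω, z) ∂(markLaw N.β ‖X b.1 b.2 ω‖)) ∂P := by
  rw [lintegral_infProd_eq_iInf, lintegral_infProd_eq_iInf]
  · exact iInf_congr fun F => hdep.lintegral_prod_marks F hψ
      fun b => measurable_lintegral_markLaw N.β (hψ b)
  · exact fun b => (measurable_lintegral_markLaw N.β (hψ b)).comp (hdep.meas_pos _ _)
  · exact fun b ω => lintegral_markLaw_le_one (mul_nonneg N.β_nonneg (norm_nonneg _))
      fun z => hψ1 b _
  · exact fun b => (hψ b).comp ((hdep.meas_pos _ _).prodMk (hdep.measurable_marks b))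
  · exact fun b ω => hψ1 b _

open Classical in
/-- Expected sum, over the stations of type `q` of operator `k` at a distance in `B`, of a product
over all other stations. -/
lemma IsDeployment.lintegral_tsum_infProd_marks [IsProbabilityMeasure P] [Fintype ι]
    (hdep : IsDeployment N P X s h θ) {u : ι → Plane × Mark → ℝ≥0∞} (hu : ∀ m, Measurable (u m))
    (hu1 : ∀ m z, u m z ≤ 1) (k : ι) (q : LinkType) {B : Set ℝ} (hB : MeasurableSet B) {R₀ : ℕ}
    (hR₀ : ∀ r ∈ B, r < R₀) :
    ∫⁻ ω, ∑' i, (if s k i ω = q ∧ ‖X k i ω‖ ∈ B then 1 else 0) *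
        infProd (fun b : ι × ℕ => if b = (k, i) then 1 else
          u b.1 (X b.1 b.2 ω, s b.1 b.2 ω, h b.1 b.2 ω, θ b.1 b.2 ω)) ∂P =
      (∫⁻ y, B.indicator 1 ‖y‖ * typeProb N.β ‖y‖ q ∂(intensity N k)) *
        nexp (∑ m, ∫⁻ y, (1 - ∫⁻ z, u m (y, z) ∂(markLaw N.β ‖y‖)) ∂(intensity N m)) := by
  let κ : Plane × Mark → ℝ≥0∞ := fun z => if z.2.1 = q ∧ ‖z.1‖ ∈ B then 1 else 0
  have hκ : Measurable κ := by
    refine Measurable.ite (MeasurableSet.inter ?_ ?_) measurable_const measurable_const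
    · exact (measurable_fst.comp measurable_snd) (MeasurableSpace.measurableSet_top (s := {q}))
    · exact (measurable_fst.norm) hB
  have hκ1 : ∀ z, κ z ≤ 1 := fun z => by
    simp only [κ]; split_ifs <;> simp
  have hκint : ∀ y : Plane, ∫⁻ z, κ (y, z) ∂(markLaw N.β ‖y‖) =
      B.indicator 1 ‖y‖ * typeProb N.β ‖y‖ q := by
    intro y
    rw [lintegral_markLaw_eq _ _ (f := fun z => κ (y, z))
      (hκ.comp (measurable_const.prodMk measurable_id))]
    by_cases hy : ‖y‖ ∈ B <;> cases q <;> simp [κ, hy]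
  have hφm : Measurable fun y : Plane => B.indicator (1 : ℝ → ℝ≥0∞) ‖y‖ * typeProb N.β ‖y‖ q :=
    ((measurable_one.indicator hB).comp measurable_norm).mul
      ((measurable_typeProb N.β q).comp measurable_norm)
  have hφ1 : ∀ y : Plane, B.indicator (1 : ℝ → ℝ≥0∞) ‖y‖ * typeProb N.β ‖y‖ q ≤ 1 := by
    intro y
    rw [← hκint]
    exact lintegral_markLaw_le_one (mul_nonneg N.β_nonneg (norm_nonneg _)) fun z => hκ1 _
  let g : ι → Plane → ℝ≥0∞ := fun m y => ∫⁻ z, u m (y, z) ∂(markLaw N.β ‖y‖)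
  have hgm : ∀ m, Measurable (g m) := fun m => measurable_lintegral_markLaw N.β (hu m)
  have hg1 : ∀ m y, g m y ≤ 1 := fun m y =>
    lintegral_markLaw_le_one (mul_nonneg N.β_nonneg (norm_nonneg _)) fun z => hu1 m _
  -- For fixed `i` the indicator `κ` takes the place of the factor of `(k, i)`, whose mean is the
  -- type probability restricted to distances in `B`.
  have hterm : ∀ i, ∫⁻ ω, (if s k i ω = q ∧ ‖X k i ω‖ ∈ B then 1 else 0) *
        infProd (fun b : ι × ℕ => if b = (k, i) then 1 else
          u b.1 (X b.1 b.2 ω, s b.1 b.2 ω, h b.1 b.2 ω, θ b.1 b.2 ω)) ∂P =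
      ∫⁻ ω, (B.indicator 1 ‖X k i ω‖ * typeProb N.β ‖X k i ω‖ q) *
        infProd (fun b : ι × ℕ => if b = (k, i) then 1 else g b.1 (X b.1 b.2 ω)) ∂P := by
    intro i
    let ψ : ι × ℕ → Plane × Mark → ℝ≥0∞ := fun b => if b = (k, i) then κ else u b.1
    have hψ : ∀ b, Measurable (ψ b) := fun b => by
      simp only [ψ]; split_ifs
      exacts [hκ, hu _]
    have hψ1 : ∀ b z, ψ b z ≤ 1 := fun b z => by
      simp only [ψ]; split_ifs
      exacts [hκ1 z, hu1 _ z]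
    have h1 := hdep.lintegral_infProd_marks hψ hψ1
    have h2 : ∀ ω, infProd (fun b => ψ b (X b.1 b.2 ω, s b.1 b.2 ω, h b.1 b.2 ω, θ b.1 b.2 ω)) =
        (if s k i ω = q ∧ ‖X k i ω‖ ∈ B then 1 else 0) *
        infProd (fun b : ι × ℕ => if b = (k, i) then 1 else
          u b.1 (X b.1 b.2 ω, s b.1 b.2 ω, h b.1 b.2 ω, θ b.1 b.2 ω)) := by
      intro ω
      rw [← infProd_ite_eq (k, i) (hκ1 (X k i ω, s k i ω, h k i ω, θ k i ω)) fun b => hu1 _ _]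
      refine congrArg infProd (funext fun b => ?_)
      by_cases hb : b = (k, i)
      · subst hb; simp [ψ]
      · simp [ψ, hb]
    have h3 : ∀ ω, infProd (fun b => ∫⁻ z, ψ b (X b.1 b.2 ω, z) ∂(markLaw N.β ‖X b.1 b.2 ω‖)) =
        (B.indicator 1 ‖X k i ω‖ * typeProb N.β ‖X k i ω‖ q) *
        infProd (fun b : ι × ℕ => if b = (k, i) then 1 else g b.1 (X b.1 b.2 ω)) := by
      intro ω
      rw [← infProd_ite_eq (k, i) (hφ1 _) fun b => hg1 _ _]
      refine congrArg infProd (funext fun b => ?_)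
      by_cases hb : b = (k, i)
      · subst hb; simp [ψ, hκint]
      · simp [ψ, hb, g]
    simp only [h2, h3] at h1
    exact h1
  have hX := hdep.meas_pos
  rw [lintegral_tsum, tsum_congr hterm, ← lintegral_tsum]
  · refine lintegral_tsum_mul_infProd_of_indep (Λ := intensity N) hX hdep.poisson hdep.indep hgm
      hg1 hφm hφ1 (R₀ := R₀) (fun y hy => ?_) k
    have : ‖y‖ ∉ B := fun h => absurd (hR₀ _ h) (not_lt.2 hy)
    simp [this]
  · refine fun i => (Measurable.mul (hφm.comp (hX k i)) (measurable_infProd fun b => ?_)).aemeasurable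
    split_ifs
    · exact measurable_const
    · exact (hgm _).comp (hX _ _)
  · refine fun i => (Measurable.mul ?_ (measurable_infProd fun b => ?_)).aemeasurable
    · exact hκ.comp ((hX k i).prodMk (hdep.measurable_marks (k, i)))
    · split_ifs
      · exact measurable_const
      · exact (hu _).comp ((hX _ _).prodMk (hdep.measurable_marks b))

end Frozen

/-! ### Exclusion radii and station weights -/

section Weight

variable {ι : Type*}

lemma exclusionRadius_nonneg (N : Params ι) (n k : ι) (q : LinkType) (m : ι) (p : LinkType) {x : ℝ}
    (hx : 0 ≤ x) : 0 ≤ exclusionRadius N n k q m p x := by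
  unfold exclusionRadius
  split_ifs
  · have := N.power_pos m; have := N.power_pos k; have := N.gain_pos p; have := N.gain_pos q
    positivity
  · exact le_rfl

lemma exclusionRadius_mono (N : Params ι) (n k : ι) (q : LinkType) (m : ι) (p : LinkType) {x y : ℝ}
    (hx : 0 ≤ x) (hxy : x ≤ y) : exclusionRadius N n k q m p x ≤ exclusionRadius N n k q m p y := by
  unfold exclusionRadius
  split_ifs
  · have := N.power_pos m; have := N.power_pos k; have := N.gain_pos p; have := N.gain_pos q
    have := N.expo_pos p; have := N.expo_pos q
    gcongr
  · exact le_rfl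

/-- Raising the radius inequality to the power `N.expo p` gives `P_m C_p / (P_k C_q) * x ^ α_q < r ^
α_p`; clearing denominators yields the comparison of received powers. -/
lemma avgPower_lt_iff (N : Params ι) {n k m : ι} (hm : m ∈ N.access n) (q p : LinkType) {x r : ℝ}
    (hx : 0 < x) (hr : 0 < r) :
    N.power m * (N.gain p * r ^ (-(N.expo p))) < N.power k * (N.gain q * x ^ (-(N.expo q))) ↔
      exclusionRadius N n k q m p x < r := by
  have h1 := N.power_pos m; have h2 := N.power_pos k; have h3 := N.gain_pos p
  have h4 := N.gain_pos q; have h5 := N.expo_pos p; have h6 := N.expo_pos q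
  rw [exclusionRadius, if_pos hm, ← Real.rpow_lt_rpow_iff (by positivity) hr.le h5,
    Real.mul_rpow (by positivity) (by positivity), ← Real.rpow_mul (by positivity),
    ← Real.rpow_mul hx.le, one_div_mul_cancel h5.ne', div_mul_cancel₀ _ h5.ne', Real.rpow_one,
    Real.rpow_neg hr.le, Real.rpow_neg hx.le]
  have h7 : 0 < r ^ N.expo p := Real.rpow_pos_of_pos hr _
  have h8 : 0 < x ^ N.expo q := Real.rpow_pos_of_pos hx _
  set r' := r ^ N.expo p
  set x' := x ^ N.expo q
  rw [← div_eq_mul_inv, ← div_eq_mul_inv, mul_div_assoc', mul_div_assoc', div_lt_div_iff₀ h7 h8,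
    div_mul_div_comm, div_mul_eq_mul_div, div_lt_iff₀ (by positivity), mul_comm r']

open Classical in
/-- Contribution of one station to the conditional Laplace transform: zero inside the exclusion
region belonging to a serving distance `v`, and otherwise the exponential of its interference. -/
noncomputable def stationWeight (N : Params ι) (n k : ι) (q : LinkType) (m₀ : ι) (p : LinkType)
    (t v : ℝ) (m : ι) (z : Plane × Mark) : ℝ≥0∞ :=
  if exclusionRadius N n k q m z.2.1 (max v 0) < ‖z.1‖ then
    if m = m₀ ∧ z.2.1 = p then
      nexp (ENNReal.ofReal t * ENNReal.ofReal (N.power m * z.2.2.1 *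
        (N.gain p * ‖z.1‖ ^ (-(N.expo p))) * antenna N z.2.2.2))
    else 1
  else 0

variable (N : Params ι) (n k : ι) (q : LinkType) (m₀ : ι) (p : LinkType) (t : ℝ)

lemma stationWeight_le_one (v : ℝ) (m : ι) (z : Plane × Mark) :
    stationWeight N n k q m₀ p t v m z ≤ 1 := by
  unfold stationWeight
  split_ifs
  · exact nexp_le_one _
  · exact le_rfl
  · exact zero_le_one

/-- The exclusion region grows with `v`, and the weight outside of it does not depend on `v`.
Truncating at `max v 0` extends this to all real `v`, as the sandwich argument on the line requires.
-/
lemma stationWeight_antitone (m : ι) (z : Plane × Mark) :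
    Antitone fun v => stationWeight N n k q m₀ p t v m z := by
  intro v w hvw
  have h1 := exclusionRadius_mono N n k q m z.2.1 (le_max_right v 0) (max_le_max_right 0 hvw)
  simp only [stationWeight]
  by_cases hw : exclusionRadius N n k q m z.2.1 (max w 0) < ‖z.1‖
  · rw [if_pos hw, if_pos (h1.trans_lt hw)]
  · rw [if_neg hw]; exact zero_le

lemma measurable_stationWeight (v : ℝ) (m : ι) :
    Measurable (stationWeight N n k q m₀ p t v m) := by
  have h3 : Measurable fun z : Plane × ℝ × ℝ => ‖z.1‖ ^ (-(N.expo p)) :=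
    measurable_fst.norm.pow_const _
  have h4 : Measurable fun z : Plane × ℝ × ℝ => antenna N z.2.2 :=
    (measurable_antenna N).comp (measurable_snd.comp measurable_snd)
  have h5 : Measurable fun z : Plane × ℝ × ℝ => N.power m * z.2.1 :=
    (measurable_fst.comp measurable_snd).const_mul _
  have h6 := measurable_nexp.comp
    (((h5.mul (h3.const_mul (N.gain p))).mul h4).ennreal_ofReal.const_mul (ENNReal.ofReal t))
  have hW : ∀ σ, Measurable fun z : Plane × ℝ × ℝ =>
      stationWeight N n k q m₀ p t v m (z.1, σ, z.2) := by
    intro σ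
    have h7 : MeasurableSet {z : Plane × ℝ × ℝ |
        exclusionRadius N n k q m σ (max v 0) < ‖z.1‖} :=
      measurableSet_lt measurable_const measurable_fst.norm
    refine Measurable.ite h7 ?_ measurable_const
    by_cases h : m = m₀ ∧ σ = p
    · simp only [if_pos h]
      exact h6
    · simp only [if_neg h]
      exact measurable_const
  have h1 : Measurable fun z : Plane × Mark => (z.2.1, (z.1, z.2.2)) :=
    (measurable_fst.comp measurable_snd).prodMk
      (measurable_fst.prodMk (measurable_snd.comp measurable_snd))
  have h2 := (measurable_linkType _ hW).comp h1
  exact h2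

/-- Mean contribution of a station at `y` to the conditional Laplace transform. -/
noncomputable def meanWeight (v : ℝ) (m : ι) (y : Plane) : ℝ≥0∞ :=
  ∫⁻ z, stationWeight N n k q m₀ p t v m (y, z) ∂(markLaw N.β ‖y‖)

lemma measurable_meanWeight (v : ℝ) (m : ι) : Measurable (meanWeight N n k q m₀ p t v m) :=
  measurable_lintegral_markLaw N.β (measurable_stationWeight N n k q m₀ p t v m)

lemma meanWeight_le_one (v : ℝ) (m : ι) (y : Plane) : meanWeight N n k q m₀ p t v m y ≤ 1 :=
  lintegral_markLaw_le_one (mul_nonneg N.β_nonneg (norm_nonneg _))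
    fun z => stationWeight_le_one N n k q m₀ p t v m (y, z)

/-- Probability-weighted product of the contributions of all stations, for serving distance `v`. -/
noncomputable def weightDensity [Fintype ι] (v : ℝ) : ℝ≥0∞ :=
  nexp (∑ m, ∫⁻ y, (1 - meanWeight N n k q m₀ p t v m y) ∂(intensity N m))

lemma weightDensity_antitone [Fintype ι] : Antitone (weightDensity N n k q m₀ p t) := by
  intro v w hvw
  refine nexp_anti (Finset.sum_le_sum fun m _ => lintegral_mono fun y => ?_)
  exact tsub_le_tsub_left (lintegral_mono fun z => stationWeight_antitone N n k q m₀ p t m _ hvw) 1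

end Weight

/-! ### The association event as a product over stations -/

section Pointwise

variable {ι Ω : Type*} {N : Params ι} {X : ι → ℕ → Ω → Plane}
  {s : ι → ℕ → Ω → LinkType} {h θ : ι → ℕ → Ω → ℝ}

/-- Association is strict: of two distinct serving stations each would be weaker than the other. -/
lemma IsServing.unique {n k k' : ι} {i i' : ℕ} {ω : Ω} (h₁ : IsServing N X s n k i ω)
    (h₂ : IsServing N X s n k' i' ω) : (k, i) = (k', i') := by
  by_contra hne
  exact lt_asymm (h₁.2 k' h₂.1 i' fun h => hne h.symm) (h₂.2 k h₁.1 i hne)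

/-- Nonzero positions are needed twice: `0 ^ (-α)` is `0` for real powers, so a station at the
origin would count as powerless, and for inaccessible operators the condition reads `0 < ‖X‖`. -/
lemma isServing_iff {n k : ι} (hk : k ∈ N.access n) {i : ℕ} {ω : Ω} {q : LinkType}
    (hX : ∀ m j, X m j ω ≠ 0) (hs : s k i ω = q) :
    IsServing N X s n k i ω ↔ ∀ b : ι × ℕ, b ≠ (k, i) →
      exclusionRadius N n k q b.1 (s b.1 b.2 ω) (max ‖X k i ω‖ 0) < ‖X b.1 b.2 ω‖ := by
  have hpos : ∀ m j, 0 < ‖X m j ω‖ := fun m j => norm_pos_iff.2 (hX m j)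
  rw [max_eq_left (norm_nonneg _)]
  refine ⟨fun hserv b hb => ?_, fun hb => ⟨hk, fun m hm j hne => ?_⟩⟩
  · by_cases hm : b.1 ∈ N.access n
    · have := hserv.2 b.1 hm b.2 hb
      rwa [avgPower, avgPower, hs, avgPower_lt_iff N hm _ _ (hpos _ _) (hpos _ _)] at this
    · rw [exclusionRadius, if_neg hm]; exact hpos _ _
  · rw [avgPower, avgPower, hs, avgPower_lt_iff N hm _ _ (hpos _ _) (hpos _ _)]
    exact hb (m, j) hne

lemma servingDist_eq {n k : ι} {i : ℕ} {ω : Ω} (hserv : IsServing N X s n k i ω) :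
    servingDist N X s n ω = ‖X k i ω‖ := by
  have hb : ∃ b : ι × ℕ, IsServing N X s n b.1 b.2 ω := ⟨(k, i), hserv⟩
  rw [servingDist, dif_pos hb]
  have h1 := hb.choose_spec.unique hserv
  simp only [Prod.mk.injEq] at h1
  rw [h1.1, h1.2]

-- One station inside its exclusion region makes the product vanish, which is the failure of
-- association. Otherwise the exponents add up to `t` times the interference, since by uniqueness
-- leaving out `(k, i)` is leaving out the serving station.
open Classical in
lemma infProd_stationWeight {n k : ι} (hk : k ∈ N.access n) {i : ℕ} {ω : Ω} {q : LinkType}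
    (hX : ∀ m j, X m j ω ≠ 0) (hs : s k i ω = q) (m₀ : ι) (p : LinkType) (t : ℝ) :
    infProd (fun b : ι × ℕ => if b = (k, i) then 1 else
      stationWeight N n k q m₀ p t ‖X k i ω‖ b.1
        (X b.1 b.2 ω, s b.1 b.2 ω, h b.1 b.2 ω, θ b.1 b.2 ω)) =
      if IsServing N X s n k i ω then
        nexp (ENNReal.ofReal t * interference N X s h θ n m₀ p ω) else 0 := by
  let a : ι × ℕ → ℝ≥0∞ := fun b => if b = (k, i) then 0 else if b.1 = m₀ ∧ s b.1 b.2 ω = p then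
    ENNReal.ofReal t * ENNReal.ofReal (N.power b.1 * h b.1 b.2 ω *
      (N.gain p * ‖X b.1 b.2 ω‖ ^ (-(N.expo p))) * antenna N (θ b.1 b.2 ω)) else 0
  have h1 : ∀ b : ι × ℕ, (if b = (k, i) then 1 else
      stationWeight N n k q m₀ p t ‖X k i ω‖ b.1
        (X b.1 b.2 ω, s b.1 b.2 ω, h b.1 b.2 ω, θ b.1 b.2 ω)) =
      if (b ≠ (k, i) → exclusionRadius N n k q b.1 (s b.1 b.2 ω) (max ‖X k i ω‖ 0) <
        ‖X b.1 b.2 ω‖) then nexp (a b) else 0 := by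
    intro b
    by_cases hb : b = (k, i)
    · simp [hb, a]
    · simp only [hb, if_false, stationWeight, a, ne_eq, not_false_eq_true, true_implies]
      split_ifs <;> simp
  simp_rw [h1]
  rw [infProd_ite, infProd_nexp, isServing_iff hk hX hs]
  split_ifs with hserv
  · have hserv' := (isServing_iff hk hX hs).2 hserv
    congr 1
    rw [show (∑' b, a b) = ∑' (m : ι) (j : ℕ), a (m, j) from ENNReal.tsum_prod', tsum_eq_single m₀,
      interference, ← ENNReal.tsum_mul_left]
    · refine tsum_congr fun j => ?_
      have h2 : IsServing N X s n m₀ j ω ↔ (m₀, j) = (k, i) := by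
        refine ⟨fun h => h.unique hserv', fun h => ?_⟩
        simp only [Prod.mk.injEq] at h
        rw [h.1, h.2]; exact hserv'
      simp only [a, h2]
      by_cases h3 : (m₀, j) = (k, i) <;> by_cases h4 : s m₀ j ω = p <;> simp [h3, h4]
    · intro m hm
      simp [a, hm]
  · rfl

open Classical in
/-- The Laplace functional on the association event as a sum over potential serving stations. -/
lemma tsum_infProd_stationWeight {n k : ι} (hk : k ∈ N.access n) {ω : Ω} (q : LinkType)
    (hX : ∀ m j, X m j ω ≠ 0) (m₀ : ι) (p : LinkType) (t : ℝ) (B : Set ℝ) :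
    ∑' i, (if s k i ω = q ∧ ‖X k i ω‖ ∈ B then 1 else 0) *
      infProd (fun b : ι × ℕ => if b = (k, i) then 1 else
        stationWeight N n k q m₀ p t ‖X k i ω‖ b.1
          (X b.1 b.2 ω, s b.1 b.2 ω, h b.1 b.2 ω, θ b.1 b.2 ω)) =
      (assocEvent N X s n k q ∩ servingDist N X s n ⁻¹' B).indicator
        (fun ω => nexp (ENNReal.ofReal t * interference N X s h θ n m₀ p ω)) ω := by
  have h1 : ∀ i, (if s k i ω = q ∧ ‖X k i ω‖ ∈ B then 1 else 0) *
      infProd (fun b : ι × ℕ => if b = (k, i) then 1 else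
        stationWeight N n k q m₀ p t ‖X k i ω‖ b.1
          (X b.1 b.2 ω, s b.1 b.2 ω, h b.1 b.2 ω, θ b.1 b.2 ω)) =
      if IsServing N X s n k i ω ∧ s k i ω = q ∧ ‖X k i ω‖ ∈ B then
        nexp (ENNReal.ofReal t * interference N X s h θ n m₀ p ω) else 0 := by
    intro i
    by_cases hs : s k i ω = q
    · rw [infProd_stationWeight hk hX hs]
      by_cases h2 : ‖X k i ω‖ ∈ B <;> by_cases h3 : IsServing N X s n k i ω <;> simp [hs, h2, h3]
    · simp [hs]
  simp_rw [h1]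
  by_cases hω : ω ∈ assocEvent N X s n k q
  · obtain ⟨i, hi, hs⟩ := hω
    rw [tsum_eq_single i]
    · have hmem : ω ∈ assocEvent N X s n k q := ⟨i, hi, hs⟩
      simp only [hi, hs, true_and, Set.indicator_apply, Set.mem_inter_iff, hmem, Set.mem_preimage,
        servingDist_eq hi]
    · intro j hj
      rw [if_neg]
      rintro ⟨h2, -⟩
      exact hj (Prod.mk.inj (h2.unique hi)).2
  · rw [Set.indicator_of_notMem fun h => hω h.1]
    refine ENNReal.tsum_eq_zero.2 fun i => if_neg ?_
    rintro ⟨h2, h3, -⟩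
    exact hω ⟨i, h2, h3⟩

end Pointwise

/-! ### Measurability, and absence of stations at the origin -/

section Measurability

variable {ι Ω : Type*} [MeasurableSpace Ω] {P : Measure Ω} {N : Params ι} {X : ι → ℕ → Ω → Plane}
  {s : ι → ℕ → Ω → LinkType} {h θ : ι → ℕ → Ω → ℝ}

lemma measurableSet_linkType_eq {s : Ω → LinkType} (hs : Measurable s) (p : LinkType) :
    MeasurableSet {ω | s ω = p} :=
  hs (MeasurableSpace.measurableSet_top (s := {p}))

lemma measurable_avgPower (hdep : IsDeployment N P X s h θ) (m : ι) (j : ℕ) :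
    Measurable (avgPower N X s m j) := by
  classical
  have h1 : avgPower N X s m j = fun ω => if s m j ω = .los then
      N.power m * (N.gain .los * ‖X m j ω‖ ^ (-(N.expo .los))) else
      N.power m * (N.gain .nlos * ‖X m j ω‖ ^ (-(N.expo .nlos))) := by
    funext ω
    cases hs : s m j ω <;> simp [avgPower, hs]
  have h2 := (hdep.meas_pos m j).norm
  rw [h1]
  exact Measurable.ite (measurableSet_linkType_eq (hdep.meas_type m j) _)
    (((h2.pow_const _).const_mul _).const_mul _) (((h2.pow_const _).const_mul _).const_mul _)

lemma measurableSet_isServing [Countable ι] (hdep : IsDeployment N P X s h θ) (n k : ι) (i : ℕ) :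
    MeasurableSet {ω | IsServing N X s n k i ω} := by
  have : {ω | IsServing N X s n k i ω} = {_ω | k ∈ N.access n} ∩
      ⋂ (m : ι) (_ : m ∈ N.access n) (j : ℕ) (_ : (m, j) ≠ (k, i)),
        {ω | avgPower N X s m j ω < avgPower N X s k i ω} := by
    ext ω; simp [IsServing]
  rw [this]
  refine (MeasurableSet.const _).inter (MeasurableSet.iInter fun m => MeasurableSet.iInter fun _ =>
    MeasurableSet.iInter fun j => MeasurableSet.iInter fun _ => ?_)
  exact measurableSet_lt (measurable_avgPower hdep m j) (measurable_avgPower hdep k i)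

lemma measurableSet_assocEvent [Countable ι] (hdep : IsDeployment N P X s h θ) (n k : ι)
    (q : LinkType) : MeasurableSet (assocEvent N X s n k q) := by
  have : assocEvent N X s n k q = ⋃ i, {ω | IsServing N X s n k i ω} ∩ {ω | s k i ω = q} := by
    ext ω; simp [assocEvent]
  rw [this]
  exact MeasurableSet.iUnion fun i => (measurableSet_isServing hdep n k i).inter
    (measurableSet_linkType_eq (hdep.meas_type k i) q)

/-- Uniqueness of the serving station makes the choice in `servingDist` harmless: preimages are
countable unions over the possible servers, together with the event that there is none. -/
lemma measurable_servingDist [Countable ι] (hdep : IsDeployment N P X s h θ) (n : ι) :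
    Measurable (servingDist N X s n) := by
  intro B hB
  have : servingDist N X s n ⁻¹' B =
      (⋃ b : ι × ℕ, {ω | IsServing N X s n b.1 b.2 ω} ∩ {ω | ‖X b.1 b.2 ω‖ ∈ B}) ∪
      ((⋃ b : ι × ℕ, {ω | IsServing N X s n b.1 b.2 ω})ᶜ ∩ {_ω | (0 : ℝ) ∈ B}) := by
    ext ω
    by_cases hb : ∃ b : ι × ℕ, IsServing N X s n b.1 b.2 ω
    · obtain ⟨b, hb'⟩ := hb
      have hmem : ω ∈ ⋃ b : ι × ℕ, {ω | IsServing N X s n b.1 b.2 ω} := Set.mem_iUnion.2 ⟨b, hb'⟩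
      rw [Set.mem_preimage, servingDist_eq hb', Set.mem_union, Set.mem_inter_iff,
        Set.mem_compl_iff]
      simp only [hmem, not_true, false_and, or_false, Set.mem_iUnion, Set.mem_inter_iff,
        Set.mem_ofPred_eq]
      refine ⟨fun h => ⟨b, hb', h⟩, ?_⟩
      rintro ⟨c, hc, hc'⟩
      have h1 := hc.unique hb'
      simp only [Prod.mk.injEq] at h1
      rwa [h1.1, h1.2] at hc'
    · have h0 : servingDist N X s n ω = 0 := by rw [servingDist, dif_neg hb]
      rw [Set.mem_preimage, h0]
      simp only [not_exists] at hb
      simp [hb]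
  rw [this]
  refine (MeasurableSet.iUnion fun b => (measurableSet_isServing hdep _ _ _).inter ?_).union
    ((MeasurableSet.iUnion fun b => measurableSet_isServing hdep _ _ _).compl.inter
      (MeasurableSet.const _))
  exact (hdep.meas_pos _ _).norm hB

omit [MeasurableSpace Ω] in
lemma servingDist_nonneg (n : ι) (ω : Ω) : 0 ≤ servingDist N X s n ω := by
  unfold servingDist
  split_ifs
  · exact norm_nonneg _
  · exact le_rfl

lemma measurable_interference [Countable ι] (hdep : IsDeployment N P X s h θ) (n m : ι)
    (p : LinkType) : Measurable (interference N X s h θ n m p) := by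
  classical
  refine Measurable.tsum fun j => Measurable.ite ?_ ?_ measurable_const
  · exact (measurableSet_linkType_eq (hdep.meas_type m j) p).inter
      (measurableSet_isServing hdep n m j).compl
  · have h1 := hdep.meas_fading m j
    have h2 := (measurable_antenna N).comp (hdep.meas_angle m j)
    have h3 := (hdep.meas_pos m j).norm
    exact ((((h1.const_mul _).mul ((h3.pow_const _).const_mul _)).mul h2)).ennreal_ofReal

/-- A single point has zero intensity, and a Poisson variable of mean zero vanishes almost surely.
-/
lemma ae_pos_ne_zero [IsProbabilityMeasure P] [Countable ι] (hdep : IsDeployment N P X s h θ) :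
    ∀ᵐ ω ∂P, ∀ m j, X m j ω ≠ 0 := by
  rw [ae_all_iff]
  intro m
  have h0 : intensity N m {0} = 0 := by simp [intensity]
  have h1 := (hdep.poisson m).law {0} (measurableSet_singleton 0)
    (by change intensity N m {0} ≠ ∞; simp [h0]) 0
  have h2 : (ENNReal.ofReal (N.density m) • volume : Measure Plane) {0} = 0 := h0
  rw [h2, ENNReal.toNNReal_zero, poissonMeasure_singleton] at h1
  have h3 : P {ω | count (X m) {0} ω = ((0 : ℕ) : ℕ∞)} = 1 := by rw [h1]; simp
  have hm : MeasurableSet {ω | count (X m) {0} ω = ((0 : ℕ) : ℕ∞)} :=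
    measurable_count (hdep.meas_pos m) (measurableSet_singleton 0) (measurableSet_singleton _)
  have h4 : ∀ᵐ ω ∂P, count (X m) {0} ω = ((0 : ℕ) : ℕ∞) :=
    (prob_compl_eq_zero_iff hm).2 h3
  filter_upwards [h4] with ω hω j hj
  rw [count, Nat.cast_zero, Set.encard_eq_zero] at hω
  have : j ∈ {j : ℕ | X m j ω ∈ ({0} : Set Plane)} := by simp [hj]
  rw [hω] at this
  exact this

end Measurability

/-! ### The weighted law of the serving distance -/

section ServingLaw

variable {ι Ω : Type*} [MeasurableSpace Ω] {P : Measure Ω} {N : Params ι} {X : ι → ℕ → Ω → Plane}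
  {s : ι → ℕ → Ω → LinkType} {h θ : ι → ℕ → Ω → ℝ}

/-- Intensity of the distances of the stations of type `q` of operator `k`. -/
noncomputable def distIntensity (N : Params ι) (k : ι) (q : LinkType) : Measure ℝ :=
  ((intensity N k).withDensity fun y => typeProb N.β ‖y‖ q).map norm

lemma distIntensity_apply (N : Params ι) (k : ι) (q : LinkType) {B : Set ℝ} (hB : MeasurableSet B) :
    distIntensity N k q B = ∫⁻ y, B.indicator 1 ‖y‖ * typeProb N.β ‖y‖ q ∂(intensity N k) := by
  rw [distIntensity, Measure.map_apply measurable_norm hB,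
    withDensity_apply _ (measurable_norm hB), ← lintegral_indicator (measurable_norm hB)]
  refine lintegral_congr fun y => ?_
  by_cases hy : ‖y‖ ∈ B
  · rw [Set.indicator_of_mem (by exact hy), Set.indicator_of_mem hy]; simp
  · rw [Set.indicator_of_notMem (by exact hy), Set.indicator_of_notMem hy]; simp

lemma lintegral_intensity_comp_norm (N : Params ι) (k : ι) {f : ℝ → ℝ≥0∞} (hf : Measurable f) :
    ∫⁻ y, f ‖y‖ ∂(intensity N k) = ENNReal.ofReal (N.density k) *
      ∫⁻ r in Set.Ioi (0 : ℝ), ENNReal.ofReal (2 * Real.pi * r) * f r := by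
  rw [intensity, lintegral_smul_measure, lintegral_comp_norm_plane hf, smul_eq_mul]

lemma distIntensity_Ico_le (N : Params ι) (k : ι) (q : LinkType) (b : ℝ) :
    ∃ C : ℝ, 0 ≤ C ∧ ∀ x y, x ≤ y → y ≤ b →
      distIntensity N k q (Set.Ico x y) ≤ ENNReal.ofReal (C * (y - x)) := by
  have hpi := Real.pi_pos
  have hden := N.density_pos k
  -- In polar coordinates the intensity has density at most `2 π λ r`, and `r ≤ max b 0` on the part
  -- of the interval that carries mass.
  refine ⟨N.density k * (2 * Real.pi * max b 0), by positivity, fun x y hxy hyb => ?_⟩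
  rw [distIntensity_apply N k q measurableSet_Ico]
  calc ∫⁻ z : Plane, (Set.Ico x y).indicator 1 ‖z‖ * typeProb N.β ‖z‖ q ∂(intensity N k)
      ≤ ∫⁻ z : Plane, (Set.Ico x y).indicator 1 ‖z‖ ∂(intensity N k) := by
        refine lintegral_mono fun z => mul_le_of_le_one_right' ?_
        exact typeProb_le_one (mul_nonneg N.β_nonneg (norm_nonneg _)) q
    _ = ENNReal.ofReal (N.density k) * ∫⁻ r in Set.Ioi (0 : ℝ),
          ENNReal.ofReal (2 * Real.pi * r) * (Set.Ico x y).indicator 1 r :=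
        lintegral_intensity_comp_norm N k (measurable_one.indicator measurableSet_Ico)
    _ ≤ ENNReal.ofReal (N.density k) * ∫⁻ r,
          (Set.Ico x y).indicator (fun _ => ENNReal.ofReal (2 * Real.pi * max b 0)) r := by
        refine mul_le_mul_right ((setLIntegral_le_lintegral _ _).trans (lintegral_mono fun r => ?_)) _
        by_cases hr : r ∈ Set.Ico x y
        · rw [Set.indicator_of_mem hr, Set.indicator_of_mem hr, Pi.one_apply, mul_one]
          have : r ≤ max b 0 := (hr.2.le.trans hyb).trans (le_max_left _ _)
          gcongr
        · rw [Set.indicator_of_notMem hr, Set.indicator_of_notMem hr, mul_zero]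
    _ = ENNReal.ofReal (N.density k * (2 * Real.pi * max b 0) * (y - x)) := by
        rw [lintegral_indicator measurableSet_Ico, setLIntegral_const, Real.volume_Ico,
          ← ENNReal.ofReal_mul (by positivity), ← ENNReal.ofReal_mul hden.le, mul_assoc (N.density k)]

/-- The law of the serving distance on the association event, weighted with the Laplace functional
of the interference. -/
noncomputable def laplaceMeasure (P : Measure Ω) (N : Params ι) (X : ι → ℕ → Ω → Plane)
    (s : ι → ℕ → Ω → LinkType) (h θ : ι → ℕ → Ω → ℝ) (n k : ι) (q : LinkType) (m₀ : ι)
    (p : LinkType) (t : ℝ) : Measure ℝ :=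
  ((P.restrict (assocEvent N X s n k q)).withDensity
    fun ω => nexp (ENNReal.ofReal t * interference N X s h θ n m₀ p ω)).map (servingDist N X s n)

lemma laplaceMeasure_apply [Countable ι] (hdep : IsDeployment N P X s h θ) (n k : ι) (q : LinkType)
    (m₀ : ι) (p : LinkType) (t : ℝ) {B : Set ℝ} (hB : MeasurableSet B) :
    laplaceMeasure P N X s h θ n k q m₀ p t B =
      ∫⁻ ω, (assocEvent N X s n k q ∩ servingDist N X s n ⁻¹' B).indicator
        (fun ω => nexp (ENNReal.ofReal t * interference N X s h θ n m₀ p ω)) ω ∂P := by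
  have hD := measurable_servingDist hdep n
  have hE := measurableSet_assocEvent hdep n k q
  rw [laplaceMeasure, Measure.map_apply hD hB, withDensity_apply _ (hD hB),
    Measure.restrict_restrict (hD hB), lintegral_indicator (hE.inter (hD hB)), Set.inter_comm]

lemma laplaceMeasure_univ_le (n k : ι) (q : LinkType) [IsProbabilityMeasure P] [Countable ι]
    (hdep : IsDeployment N P X s h θ) (m₀ : ι) (p : LinkType) (t : ℝ) :
    laplaceMeasure P N X s h θ n k q m₀ p t Set.univ ≤ 1 := by
  rw [laplaceMeasure_apply hdep _ _ _ _ _ _ MeasurableSet.univ]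
  refine (lintegral_mono (g := fun _ => 1) fun ω => ?_).trans (by simp)
  exact Set.indicator_le_self' (fun _ _ => zero_le) ω |>.trans (nexp_le_one _)

/-- Density of the weighted law of the serving distance. -/
lemma laplaceMeasure_eq [IsProbabilityMeasure P] [Fintype ι] (hdep : IsDeployment N P X s h θ)
    {n k : ι} (hk : k ∈ N.access n) (q : LinkType) (m₀ : ι) (p : LinkType) (t : ℝ) :
    laplaceMeasure P N X s h θ n k q m₀ p t =
      (distIntensity N k q).withDensity (weightDensity N n k q m₀ p t) := by
  classical
  have hfin : IsFiniteMeasure (laplaceMeasure P N X s h θ n k q m₀ p t) :=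
    ⟨(laplaceMeasure_univ_le n k q hdep m₀ p t).trans_lt ENNReal.one_lt_top⟩
  -- Here the threshold in the weights is the distance of the candidate itself.
  have hexact : ∀ B, MeasurableSet B → laplaceMeasure P N X s h θ n k q m₀ p t B =
      ∫⁻ ω, ∑' i, (if s k i ω = q ∧ ‖X k i ω‖ ∈ B then 1 else 0) *
        infProd (fun b : ι × ℕ => if b = (k, i) then 1 else
          stationWeight N n k q m₀ p t ‖X k i ω‖ b.1
            (X b.1 b.2 ω, s b.1 b.2 ω, h b.1 b.2 ω, θ b.1 b.2 ω)) ∂P := by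
    intro B hB
    rw [laplaceMeasure_apply hdep _ _ _ _ _ _ hB]
    refine lintegral_congr_ae ?_
    filter_upwards [ae_pos_ne_zero hdep] with ω hω
    exact (tsum_infProd_stationWeight hk q hω m₀ p t B).symm
  -- With a constant threshold the marked Mecke formula applies. The upper bound on `B` supplies the
  -- bounded support it asks for.
  have hfrozen : ∀ (v b : ℝ) (B : Set ℝ), MeasurableSet B → (∀ r ∈ B, r < b) →
      ∫⁻ ω, ∑' i, (if s k i ω = q ∧ ‖X k i ω‖ ∈ B then 1 else 0) *
        infProd (fun b : ι × ℕ => if b = (k, i) then 1 else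
          stationWeight N n k q m₀ p t v b.1
            (X b.1 b.2 ω, s b.1 b.2 ω, h b.1 b.2 ω, θ b.1 b.2 ω)) ∂P =
      weightDensity N n k q m₀ p t v * distIntensity N k q B := by
    intro v b B hB hBb
    obtain ⟨R₀, hR₀⟩ := exists_nat_gt b
    rw [hdep.lintegral_tsum_infProd_marks (measurable_stationWeight N n k q m₀ p t v)
      (stationWeight_le_one N n k q m₀ p t v) k q hB
      (R₀ := R₀) (fun r hr => (hBb r hr).trans hR₀), mul_comm, ← distIntensity_apply N k q hB]
    rfl
  -- For a candidate at distance in `[a, b)`, freezing the threshold at `a` enlarges every factor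
  -- and freezing it at `b` shrinks every factor.
  refine eq_withDensity_of_sandwich (weightDensity_antitone N n k q m₀ p t)
    (fun v => nexp_le_one _) (fun a b _ => ?_) (fun a b _ => ?_) (distIntensity_Ico_le N k q)
  · rw [hexact _ measurableSet_Ico, ← hfrozen a b _ measurableSet_Ico fun r hr => hr.2]
    refine lintegral_mono fun ω => ENNReal.tsum_le_tsum fun i => ?_
    by_cases hi : s k i ω = q ∧ ‖X k i ω‖ ∈ Set.Ico a b
    · simp only [if_pos hi]
      refine mul_le_mul_right (infProd_mono fun b => ?_) _
      split_ifs
      · exact le_rfl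
      · exact stationWeight_antitone N n k q m₀ p t _ _ hi.2.1
    · simp only [if_neg hi, zero_mul, le_refl]
  · rw [hexact _ measurableSet_Ico, ← hfrozen b b _ measurableSet_Ico fun r hr => hr.2]
    refine lintegral_mono fun ω => ENNReal.tsum_le_tsum fun i => ?_
    by_cases hi : s k i ω = q ∧ ‖X k i ω‖ ∈ Set.Ico a b
    · simp only [if_pos hi]
      refine mul_le_mul_right (infProd_mono fun b => ?_) _
      split_ifs
      · exact le_rfl
      · exact stationWeight_antitone N n k q m₀ p t _ _ hi.2.2.le
    · simp only [if_neg hi, zero_mul, le_refl]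

end ServingLaw

/-! ### Factoring the exclusion out of the density -/

section Loss

variable {ι : Type*} (N : Params ι) (n k : ι) (q : LinkType) (m₀ : ι) (p : LinkType) (t : ℝ)

/-- Average received power without antenna gain, multiplied with the transform argument. -/
noncomputable def scaledPower (m : ι) (r : ℝ) : ℝ :=
  t * (N.power m * (N.gain p * r ^ (-(N.expo p))))

lemma scaledPower_nonneg (ht : 0 ≤ t) (m : ι) {r : ℝ} (hr : 0 ≤ r) :
    0 ≤ scaledPower N p t m r := by
  have h1 := N.power_pos m; have h2 := N.gain_pos p
  unfold scaledPower
  positivity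

open Classical in
lemma lintegral_stationWeight (ht : 0 ≤ t) (v : ℝ) (m : ι) (y : Plane) (σ : LinkType) :
    ∫⁻ z, stationWeight N n k q m₀ p t v m (y, σ, z) ∂((expMeasure 1).prod angleLaw) =
      if exclusionRadius N n k q m σ (max v 0) < ‖y‖ then
        if m = m₀ ∧ σ = p then fadingLaplace N (scaledPower N p t m ‖y‖) else 1
      else 0 := by
  unfold stationWeight
  by_cases h1 : exclusionRadius N n k q m σ (max v 0) < ‖y‖
  · by_cases h2 : m = m₀ ∧ σ = p
    · simp only [h1, if_true, if_pos h2]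
      rw [← lintegral_fading_antenna N (scaledPower_nonneg N p t ht m (norm_nonneg y))]
      refine lintegral_congr fun z => ?_
      rw [← ENNReal.ofReal_mul ht]
      congr 2
      unfold scaledPower
      ring
    · simp [h1, h2]
  · simp [h1]

open Classical in
/-- Probability that a station at distance `r` lies outside of the exclusion region, has the given
type, and is lost in the Laplace transform. -/
noncomputable def lossAt (v : ℝ) (r : ℝ) : ℝ≥0∞ :=
  typeProb N.β r p * if exclusionRadius N n k q m₀ p (max v 0) < r then
    fadingLoss N (scaledPower N p t m₀ r) else 0

lemma fadingLaplace_zero : fadingLaplace N 0 = 1 := by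
  have := fadingLaplace_add_fadingLoss N le_rfl
  simpa [fadingLoss] using this

-- At transform argument `0` only the exclusion remains. Raising it to `t` lowers the weight only
-- for the chosen operator and type outside the exclusion region, where `fadingLaplace` and
-- `fadingLoss` sum to one.
open Classical in
lemma meanWeight_add_lossAt (ht : 0 ≤ t) (v : ℝ) (m : ι) (y : Plane) :
    meanWeight N n k q m₀ p t v m y +
      (if m = m₀ then lossAt N n k q m₀ p t v ‖y‖ else 0) = meanWeight N n k q m₀ p 0 v m y := by
  have hm : ∀ t, Measurable fun z : Mark => stationWeight N n k q m₀ p t v m (y, z) := fun t =>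
    (measurable_stationWeight N n k q m₀ p t v m).comp (measurable_const.prodMk measurable_id)
  have h0 : scaledPower N p 0 m ‖y‖ = 0 := by simp [scaledPower]
  rw [meanWeight, meanWeight, lintegral_markLaw_eq _ _ (hm t), lintegral_markLaw_eq _ _ (hm 0)]
  simp only [lintegral_stationWeight N n k q m₀ p t ht,
    lintegral_stationWeight N n k q m₀ p 0 le_rfl, h0, fadingLaplace_zero, ite_self]
  by_cases hm₀ : m = m₀
  · subst hm₀
    have h1 := fadingLaplace_add_fadingLoss N (scaledPower_nonneg N p t ht m (norm_nonneg y))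
    have h2 : ∀ a b c d : ℝ≥0∞, a * b + d + a * c = a * (b + c) + d := fun a b c d => by ring
    have h3 : ∀ a b c d : ℝ≥0∞, d + a * b + a * c = d + a * (b + c) := fun a b c d => by ring
    cases p
    · by_cases hex : exclusionRadius N n k q m .los (max v 0) < ‖y‖
      · simp only [lossAt, hex, true_and, if_true, reduceCtorEq, if_false]
        rw [h2, h1]
      · simp [lossAt, hex]
    · by_cases hex : exclusionRadius N n k q m .nlos (max v 0) < ‖y‖
      · simp only [lossAt, hex, true_and, if_true, reduceCtorEq, if_false]
        rw [h3, h1]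
      · simp [lossAt, hex]
  · simp [hm₀]

lemma measurable_fadingLoss : Measurable (fadingLoss N) := by
  unfold fadingLoss
  fun_prop

lemma measurable_lossAt (v : ℝ) : Measurable (lossAt N n k q m₀ p t v) := by
  refine (measurable_typeProb N.β p).mul (Measurable.ite
    (measurableSet_lt measurable_const measurable_id) ?_ measurable_const)
  refine (measurable_fadingLoss N).comp ?_
  unfold scaledPower
  exact (((measurable_id.pow_const _).const_mul _).const_mul _).const_mul _

/-- One minus the mean weight at `t` is one minus the mean weight at `0` plus the loss. The first
summand is common to the weighted and unweighted laws and cancels on conditioning. -/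
lemma weightDensity_eq_mul [Fintype ι] (ht : 0 ≤ t) (v : ℝ) :
    weightDensity N n k q m₀ p t v = weightDensity N n k q m₀ p 0 v *
      nexp (∫⁻ y, lossAt N n k q m₀ p t v ‖y‖ ∂(intensity N m₀)) := by
  classical
  have h1 : ∀ m y, 1 - meanWeight N n k q m₀ p t v m y =
      (1 - meanWeight N n k q m₀ p 0 v m y) +
        (if m = m₀ then lossAt N n k q m₀ p t v ‖y‖ else 0) := by
    intro m y
    have h2 := meanWeight_add_lossAt N n k q m₀ p t ht v m y
    have h3 := meanWeight_le_one N n k q m₀ p 0 v m y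
    have h4 := ne_top_of_le_ne_top ENNReal.one_ne_top (meanWeight_le_one N n k q m₀ p t v m y)
    refine (ENNReal.eq_sub_of_add_eq h4 ?_).symm
    rw [add_assoc, add_comm _ (meanWeight N n k q m₀ p t v m y), h2, tsub_add_cancel_of_le h3]
  rw [weightDensity, weightDensity, ← nexp_add]
  congr 1
  simp_rw [h1]
  have h5 : ∀ m, ∫⁻ y, ((1 - meanWeight N n k q m₀ p 0 v m y) +
      (if m = m₀ then lossAt N n k q m₀ p t v ‖y‖ else 0)) ∂(intensity N m) =
      ∫⁻ y, (1 - meanWeight N n k q m₀ p 0 v m y) ∂(intensity N m) +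
      if m = m₀ then ∫⁻ y, lossAt N n k q m₀ p t v ‖y‖ ∂(intensity N m) else 0 := by
    intro m
    have hm : Measurable fun y => 1 - meanWeight N n k q m₀ p 0 v m y :=
      measurable_const.sub (measurable_meanWeight N n k q m₀ p 0 v m)
    rw [lintegral_add_left hm]
    split_ifs <;> simp
  simp_rw [h5]
  rw [Finset.sum_add_distrib]
  simp

/-- Common form of `FL` and `FN`. -/
noncomputable def typeIntegral (p : LinkType) (b a A x : ℝ) : ℝ≥0∞ :=
  ∫⁻ y in Set.Ioi x, typeProb b y p * ENNReal.ofReal (A * y ^ (-a) / (1 + A * y ^ (-a))) *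
    ENNReal.ofReal y

lemma FL_eq_typeIntegral (b a : ℝ) {A x : ℝ} (hA : 0 ≤ A) (hx : 0 ≤ x) :
    FL b a A x = typeIntegral .los b a A x := by
  refine setLIntegral_congr_fun measurableSet_Ioi fun y hy => ?_
  have hy0 : 0 < y := hx.trans_lt hy
  have h1 : 0 ≤ A * y ^ (-a) / (1 + A * y ^ (-a)) := by positivity
  simp only [typeProb]
  rw [ENNReal.ofReal_mul (by positivity), ENNReal.ofReal_mul (Real.exp_pos _).le]

lemma FN_eq_typeIntegral {b : ℝ} (hb : 0 ≤ b) (a : ℝ) {A x : ℝ} (hA : 0 ≤ A) (hx : 0 ≤ x) :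
    FN b a A x = typeIntegral .nlos b a A x := by
  refine setLIntegral_congr_fun measurableSet_Ioi fun y hy => ?_
  have hy0 : 0 < y := hx.trans_lt hy
  have h1 : 0 ≤ A * y ^ (-a) / (1 + A * y ^ (-a)) := by positivity
  have h2 : 0 ≤ 1 - Real.exp (-(b * y)) :=
    sub_nonneg.2 (Real.exp_le_one_iff.2 (neg_nonpos.2 (by positivity)))
  simp only [typeProb]
  rw [ENNReal.ofReal_mul (mul_nonneg h2 h1), ENNReal.ofReal_mul h2]

lemma measurable_typeIntegral (p : LinkType) (b a A : ℝ) : Measurable (typeIntegral p b a A) := by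
  have : Antitone (typeIntegral p b a A) := fun x y hxy =>
    lintegral_mono_set (Set.Ioi_subset_Ioi hxy)
  exact this.measurable

/-- Exponent of the conditional Laplace transform. -/
noncomputable def laplaceExponent (x : ℝ) : ℝ≥0∞ :=
  2 * ENNReal.ofReal (N.density m₀) *
    (ENNReal.ofReal N.θb * typeIntegral p N.β (N.expo p) (t * N.G₁ * N.power m₀ * N.gain p)
        (exclusionRadius N n k q m₀ p x) +
      ENNReal.ofReal (Real.pi - N.θb) *
        typeIntegral p N.β (N.expo p) (t * N.G₂ * N.power m₀ * N.gain p)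
          (exclusionRadius N n k q m₀ p x))

lemma measurable_laplaceExponent : Measurable (laplaceExponent N n k q m₀ p t) := by
  have h1 : Measurable (exclusionRadius N n k q m₀ p) := by
    unfold exclusionRadius
    split_ifs
    · exact (measurable_id.pow_const _).const_mul _
    · exact measurable_const
  unfold laplaceExponent
  exact ((((measurable_typeIntegral _ _ _ _).comp h1).const_mul _).add
    (((measurable_typeIntegral _ _ _ _).comp h1).const_mul _)).const_mul _

/-- The factor `2 π r` of polar coordinates cancels the `π` in the lobe probabilities, leaving the
prefactor `2 λ` and the lobe weights `θb` and `π - θb`. The exclusion indicator becomes the lower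
limit of integration. -/
lemma lintegral_lossAt (v : ℝ) :
    ∫⁻ y, lossAt N n k q m₀ p t v ‖y‖ ∂(intensity N m₀) =
      laplaceExponent N n k q m₀ p t (max v 0) := by
  classical
  set R := exclusionRadius N n k q m₀ p (max v 0) with hR
  have hR0 : 0 ≤ R := exclusionRadius_nonneg N n k q m₀ p (le_max_right v 0)
  let I : ℝ → ℝ → ℝ≥0∞ := fun A r => typeProb N.β r p *
    ENNReal.ofReal (A * r ^ (-(N.expo p)) / (1 + A * r ^ (-(N.expo p)))) * ENNReal.ofReal r
  have hI : ∀ A, Measurable (I A) := fun A => by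
    have h1 : Measurable fun r : ℝ => r ^ (-(N.expo p)) := measurable_id.pow_const _
    have h2 := measurable_typeProb N.β p
    exact (h2.mul ((h1.const_mul A).div ((h1.const_mul A).const_add 1)).ennreal_ofReal).mul
      measurable_id.ennreal_ofReal
  have hpt : ∀ r, ENNReal.ofReal (2 * Real.pi * r) * lossAt N n k q m₀ p t v r =
      (Set.Ioi R).indicator (fun r => 2 * (ENNReal.ofReal N.θb *
        I (t * N.G₁ * N.power m₀ * N.gain p) r + ENNReal.ofReal (Real.pi - N.θb) *
        I (t * N.G₂ * N.power m₀ * N.gain p) r)) r := by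
    intro r
    by_cases hr : R < r
    · rw [Set.indicator_of_mem (by exact hr), lossAt, if_pos hr, fadingLoss]
      have hpi := Real.pi_pos
      have h1 : ∀ G, scaledPower N p t m₀ r * G =
          t * G * N.power m₀ * N.gain p * r ^ (-(N.expo p)) := fun G => by
        unfold scaledPower; ring
      have h2 : ∀ a : ℝ, ENNReal.ofReal Real.pi * ENNReal.ofReal (a / Real.pi) = ENNReal.ofReal a :=
        fun a => by rw [← ENNReal.ofReal_mul hpi.le, mul_div_cancel₀ _ hpi.ne']
      rw [ENNReal.ofReal_mul (by positivity), ENNReal.ofReal_mul zero_le_two, h1, h1,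
        ← h2 N.θb, ← h2 (Real.pi - N.θb), ENNReal.ofReal_ofNat]
      simp only [I]
      ring
    · rw [Set.indicator_of_notMem (by exact hr), lossAt, if_neg hr, mul_zero, mul_zero]
  rw [lintegral_intensity_comp_norm N m₀ (measurable_lossAt N n k q m₀ p t v)]
  simp_rw [hpt]
  rw [setLIntegral_indicator measurableSet_Ioi, Set.inter_eq_left.2 (Set.Ioi_subset_Ioi hR0),
    lintegral_const_mul _ (((hI _).const_mul _).fun_add ((hI _).const_mul _)),
    lintegral_add_left ((hI _).const_mul _), lintegral_const_mul _ (hI _),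
    lintegral_const_mul _ (hI _), ← mul_assoc, mul_comm (ENNReal.ofReal _) 2]
  rfl

end Loss

/-! ### Conditional Laplace transform -/

section Main

variable {ι Ω : Type*} [MeasurableSpace Ω] {P : Measure Ω} {N : Params ι} {X : ι → ℕ → Ω → Plane}
  {s : ι → ℕ → Ω → LinkType} {h θ : ι → ℕ → Ω → ℝ}

/-- The conditional Laplace transform in integrated form. -/
lemma setLIntegral_nexp_interference [IsProbabilityMeasure P] [Fintype ι]
    (hdep : IsDeployment N P X s h θ) {n k : ι} (hk : k ∈ N.access n) (q : LinkType) (m : ι)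
    (p : LinkType) {t : ℝ} (ht : 0 ≤ t) {B : Set ℝ} (hB : MeasurableSet B) :
    ∫⁻ ω in servingDist N X s n ⁻¹' B, nexp (ENNReal.ofReal t * interference N X s h θ n m p ω)
        ∂(P.restrict (assocEvent N X s n k q)) =
      ∫⁻ ω in servingDist N X s n ⁻¹' B,
        nexp (laplaceExponent N n k q m p t (servingDist N X s n ω))
        ∂(P.restrict (assocEvent N X s n k q)) := by
  have hD := measurable_servingDist hdep n
  have hmax : Measurable fun v : ℝ => nexp (laplaceExponent N n k q m p t (max v 0)) :=
    measurable_nexp.comp ((measurable_laplaceExponent N n k q m p t).comp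
      (measurable_id.max measurable_const))
  have hanti := (weightDensity_antitone N n k q m p 0).measurable
  -- At `t = 0` the weight is one even where the interference is infinite, because `0 * ∞ = 0`.
  have h0 : laplaceMeasure P N X s h θ n k q m p 0 =
      (P.restrict (assocEvent N X s n k q)).map (servingDist N X s n) := by
    simp [laplaceMeasure]
  -- Both laws have densities with respect to `distIntensity`, and these differ by the factor `nexp`
  -- of the loss integral.
  have h1 : laplaceMeasure P N X s h θ n k q m p t =
      (laplaceMeasure P N X s h θ n k q m p 0).withDensity
        fun v => nexp (laplaceExponent N n k q m p t (max v 0)) := by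
    rw [laplaceMeasure_eq hdep hk, laplaceMeasure_eq hdep hk, ← withDensity_mul _ hanti hmax]
    congr 1
    funext v
    rw [weightDensity_eq_mul N n k q m p t ht, lintegral_lossAt]
    rfl
  have h2 := congrArg (fun μ => μ B) h1
  rw [h0, withDensity_apply _ hB, setLIntegral_map hB hmax hD, laplaceMeasure,
    Measure.map_apply hD hB, withDensity_apply _ (hD hB)] at h2
  rw [h2]
  refine lintegral_congr fun ω => ?_
  rw [max_eq_left (servingDist_nonneg n ω)]

/-- Sets measurable with respect to the serving distance are its preimages, so the integrated
identity is exactly the averaging property of conditional expectation; the normalisation in `cond`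
is the same constant on both sides. -/
lemma condLaplace_ae_eq [IsProbabilityMeasure P] [Fintype ι]
    (hdep : IsDeployment N P X s h θ) {n k : ι} (hk : k ∈ N.access n) (q : LinkType) (m : ι)
    (p : LinkType) {t : ℝ} (ht : 0 ≤ t) :
    condLaplace P (assocEvent N X s n k q) (servingDist N X s n) (interference N X s h θ n m p) t
      =ᵐ[ProbabilityTheory.cond P (assocEvent N X s n k q)]
      fun ω => expNeg (laplaceExponent N n k q m p t (servingDist N X s n ω)) := by
  set E := assocEvent N X s n k q
  set D := servingDist N X s n
  have hD : Measurable D := measurable_servingDist hdep n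
  have hI := measurable_interference hdep n m p
  have hL := measurable_laplaceExponent N n k q m p t
  have hmZ : Measurable fun ω => nexp (ENNReal.ofReal t * interference N X s h θ n m p ω) :=
    measurable_nexp.comp (hI.const_mul _)
  have hmL : Measurable fun ω => nexp (laplaceExponent N n k q m p t (D ω)) :=
    measurable_nexp.comp (hL.comp hD)
  have hbound : ∀ z, ‖expNeg z‖ ≤ 1 := fun z => by
    rw [Real.norm_of_nonneg (expNeg_nonneg z), ← nexp_toReal]
    exact ENNReal.toReal_le_of_le_ofReal zero_le_one (by simpa using nexp_le_one z)
  have hint : ∀ {f : Ω → ℝ≥0∞}, Measurable (fun ω => nexp (f ω)) → ∀ (μ : Measure Ω)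
      [IsFiniteMeasure μ], Integrable (fun ω => expNeg (f ω)) μ := by
    intro f hf μ _
    refine Integrable.of_bound ?_ 1 (ae_of_all _ fun ω => hbound _)
    simp_rw [← nexp_toReal]
    exact hf.ennreal_toReal.aestronglyMeasurable
  have hconv : ∀ {f : Ω → ℝ≥0∞}, Measurable (fun ω => nexp (f ω)) → ∀ μ : Measure Ω,
      ∫ ω, expNeg (f ω) ∂μ = (∫⁻ ω, nexp (f ω) ∂μ).toReal := by
    intro f hf μ
    simp_rw [← nexp_toReal]
    exact integral_toReal hf.aemeasurable
      (ae_of_all _ fun ω => (nexp_le_one _).trans_lt ENNReal.one_lt_top)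
  symm
  refine ae_eq_condExp_of_forall_setIntegral_eq hD.comap_le (hint hmZ _)
    (fun S _ _ => (hint hmL _).integrableOn) ?_ ?_
  · rintro _ ⟨B, hB, rfl⟩ _
    rw [hconv hmL, hconv hmZ]
    congr 1
    have h1 := setLIntegral_nexp_interference hdep hk q m p ht hB
    rw [ProbabilityTheory.cond, Measure.restrict_smul, lintegral_smul_measure,
      lintegral_smul_measure]
    exact congrArg _ h1.symm
  · simp_rw [← nexp_toReal]
    refine Measurable.aestronglyMeasurable ?_
    exact ((measurable_nexp.comp hL).ennreal_toReal).comp (comap_measurable D)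

end Main

end MmWave

theorem lemma1 {ι : Type*} [Finite ι] {Ω : Type*} [MeasurableSpace Ω] (P : Measure Ω)
    [IsProbabilityMeasure P] (N : MmWave.Params ι)
    (X : ι → ℕ → Ω → MmWave.Plane) (s : ι → ℕ → Ω → MmWave.LinkType) (h θ : ι → ℕ → Ω → ℝ)
    (hdep : MmWave.IsDeployment N P X s h θ)
    (n k m : ι) (hk : k ∈ N.access n) (q : MmWave.LinkType) (t : ℝ) (ht : 0 ≤ t) :
    (MmWave.condLaplace P (MmWave.assocEvent N X s n k q) (MmWave.servingDist N X s n)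
        (MmWave.interference N X s h θ n m .los) t
      =ᵐ[ProbabilityTheory.cond P (MmWave.assocEvent N X s n k q)]
      fun ω => MmWave.expNeg (2 * ENNReal.ofReal (N.density m) *
        (ENNReal.ofReal N.θb *
            MmWave.FL N.β (N.expo .los) (t * N.G₁ * N.power m * N.gain .los)
              (MmWave.exclusionRadius N n k q m .los (MmWave.servingDist N X s n ω)) +
          ENNReal.ofReal (Real.pi - N.θb) *
            MmWave.FL N.β (N.expo .los) (t * N.G₂ * N.power m * N.gain .los)
              (MmWave.exclusionRadius N n k q m .los (MmWave.servingDist N X s n ω))))) ∧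
    (MmWave.condLaplace P (MmWave.assocEvent N X s n k q) (MmWave.servingDist N X s n)
        (MmWave.interference N X s h θ n m .nlos) t
      =ᵐ[ProbabilityTheory.cond P (MmWave.assocEvent N X s n k q)]
      fun ω => MmWave.expNeg (2 * ENNReal.ofReal (N.density m) *
        (ENNReal.ofReal N.θb *
            MmWave.FN N.β (N.expo .nlos) (t * N.G₁ * N.power m * N.gain .nlos)
              (MmWave.exclusionRadius N n k q m .nlos (MmWave.servingDist N X s n ω)) +
          ENNReal.ofReal (Real.pi - N.θb) *
            MmWave.FN N.β (N.expo .nlos) (t * N.G₂ * N.power m * N.gain .nlos)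
              (MmWave.exclusionRadius N n k q m .nlos (MmWave.servingDist N X s n ω))))) := by
  classical
  have := Fintype.ofFinite ι
  have hP := N.power_pos m
  have hD := fun p ω => MmWave.exclusionRadius_nonneg N n k q m p
    (MmWave.servingDist_nonneg (N := N) (X := X) (s := s) n ω)
  have hA : ∀ G p, 0 ≤ G → 0 ≤ t * G * N.power m * N.gain p := fun G p hG => by
    have := N.gain_pos p
    positivity
  constructor
  · refine (MmWave.condLaplace_ae_eq hdep hk q m .los ht).trans (ae_of_all _ fun ω => ?_)
    dsimp only
    rw [MmWave.FL_eq_typeIntegral _ _ (hA _ _ N.G₁_nonneg) (hD _ _),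
      MmWave.FL_eq_typeIntegral _ _ (hA _ _ N.G₂_nonneg) (hD _ _)]
    rfl
  · refine (MmWave.condLaplace_ae_eq hdep hk q m .nlos ht).trans (ae_of_all _ fun ω => ?_)
    dsimp only
    rw [MmWave.FN_eq_typeIntegral N.β_nonneg _ (hA _ _ N.G₁_nonneg) (hD _ _),
      MmWave.FN_eq_typeIntegral N.β_nonneg _ (hA _ _ N.G₂_nonneg) (hD _ _)]
    rfl
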